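/- **Theorem 1.1.** For every integer $d\ge 1$ there is a constant $C_d>0$, depending only on $d$, such that for every $\delta\in(0,1)$ there exists a compact set $K_\delta\subseteq\mathbb{R}^{d+1}$ which contains, for every $r\in[1,2]$, a sphere $\{x\in\mathbb{R}^{d+1}:|x-c|=r\}$ of radius $r$ (with some centre $c=c(r)\in\mathbb{R}^{d+1}$), and whose $\delta$-neighbourhood $N_\delta(K_\delta)=\{x:\operatorname{dist}(x,K_\delta)<\delta\}$ has Lebesgue measure $$|N_\delta(K_\delta)|\le C_d\,|\log\delta|^{-2/d}.$$ For $d=2$ this order is optimal: there is an absolute constant $c_0>0$ such that for every $\delta\in(0,1/2]$ and every compact set $K\subseteq\mathbb{R}^3$ containing a sphere of every radius $r\in[1,2]$, one has $|N_\delta(K)|\ge c_0\,|\log\delta|^{-1}$. -/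

import Mathlib

open MeasureTheory

/-- `K ⊆ ℝ^{d+1}` contains a `d`-sphere (with some centre) of every radius `r ∈ [1,2]`. -/
def ContainsAllSpheres (d : ℕ) (K : Set (EuclideanSpace ℝ (Fin (d + 1)))) : Prop :=
  ∀ r ∈ Set.Icc (1 : ℝ) 2, ∃ c : EuclideanSpace ℝ (Fin (d + 1)), Metric.sphere c r ⊆ K

/-! Upper bound. A sphere of radius `r` whose centre `c` is small meets the ray through a unit
vector `e` at distance about `r + ⟪e, c⟫`. Index the radii `1 + i / 2 ^ L` by `i < 2 ^ L`, and let
the `p`-th binary digit of `i` push the centre along `-w p` by exactly its contribution to the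
radius. The digit then shifts the crossing point only by `2 ^ p / 2 ^ L * (1 - ⟪e, w p⟫)`, which is
quadratic in `‖e - w p‖`. If `w` is a walk with steps at most `ε` and `w q` is `ε`-close to `e`, the
digits below `q` together move the crossing by `O(ε² 2 ^ q / 2 ^ L)`, because the weights `2 ^ p`
beat the quadratic growth of `‖e - w p‖²`. The higher digits leave only `2 ^ (L - q)` blocks, so the
ray meets the set in length `O(ε²)`, whatever `q` is.

A walk of `M ^ d` steps of size `O(1 / M)` can come `O(1 / M)`-close to every point of the
`d`-sphere. Hence about `M ^ d` digits suffice: `|log δ|` is comparable to `M ^ d`, and integration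
in polar coordinates gives measure `O(M⁻²)`. A further `2 * M` digits at each end make the
second-order terms and the annulus width negligible.

Lower bound in dimension three. Take about `1 / δ` annuli of width `δ` with `δ`-separated radii. Two
of them overlap in measure `O(δ² / dist a b)` for centres `a`, `b`, and if they meet then `dist a b`
is at least roughly the difference of the radii. The overlaps sum to `O(|log δ|)` while the annuli
have total measure bounded below, so Cauchy–Schwarz concludes. -/

/-! ### Polar coordinates -/

/-- The Jacobian `ρ ^ d` is at most `R ^ d` on `S`, which reduces the estimate to lengths along
rays. -/
theorem measure_le_of_radial_slices {E : Type*} [NormedAddCommGroup E] [NormedSpace ℝ E]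
    [MeasurableSpace E] [BorelSpace E] [FiniteDimensional ℝ E] [Nontrivial E]
    (μ : Measure E) [μ.IsAddHaarMeasure] {d : ℕ} (hd : Module.finrank ℝ E = d + 1)
    {S : Set E} (hS : MeasurableSet S) {R : ℝ} (hR : ∀ x ∈ S, ‖x‖ ≤ R) {m : ENNReal}
    (h : ∀ e : E, ‖e‖ = 1 → volume {ρ : ℝ | 0 < ρ ∧ ρ • e ∈ S} ≤ m) :
    μ S ≤ μ.toSphere Set.univ * (ENNReal.ofReal (R ^ d) * m) := by
  have hmp := μ.measurePreserving_homeomorphUnitSphereProd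
  have hdim : Module.finrank ℝ E - 1 = d := by omega
  rw [hdim] at hmp
  have hU : MeasurableSet (((↑) : ({0}ᶜ : Set E) → E) ⁻¹' S) := measurable_subtype_coe hS
  have h1 : μ S = μ.comap ((↑) : ({0}ᶜ : Set E) → E) ((↑) ⁻¹' S) := by
    rw [comap_subtype_coe_apply (measurableSet_singleton _).compl, Subtype.image_preimage_coe,
      Set.inter_comm, ← Set.sdiff_eq, measure_sdiff_null (measure_singleton _)]
  have h2 : μ.comap ((↑) : ({0}ᶜ : Set E) → E) ((↑) ⁻¹' S)
      = (μ.toSphere.prod (Measure.volumeIoiPow d))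
        ((homeomorphUnitSphereProd E).symm ⁻¹' ((↑) ⁻¹' S)) := by
    rw [← hmp.measure_preimage
      (((homeomorphUnitSphereProd E).symm.measurable hU).nullMeasurableSet)]
    congr 1
    ext x
    simp
  have hV := (homeomorphUnitSphereProd E).symm.measurable hU
  rw [h1, h2, Measure.prod_apply hV]
  calc _ ≤ ∫⁻ _ : Metric.sphere (0 : E) 1, (ENNReal.ofReal (R ^ d) * m) ∂μ.toSphere := by
        refine lintegral_mono fun e => ?_
        have he : ‖(e : E)‖ = 1 := by simp
        have hW := measurable_prodMk_left (x := e) hV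
        set W : Set (Set.Ioi (0 : ℝ)) :=
          Prod.mk e ⁻¹' ((homeomorphUnitSphereProd E).symm ⁻¹' ((↑) ⁻¹' S)) with hWdef
        have hmem : ∀ r : Set.Ioi (0 : ℝ), r ∈ W ↔ (r : ℝ) • (e : E) ∈ S := fun r => by
          simp [hWdef, homeomorphUnitSphereProd]
        rw [Measure.volumeIoiPow, withDensity_apply _ hW]
        calc _ ≤ ∫⁻ _ in W, ENNReal.ofReal (R ^ d) ∂(Measure.comap Subtype.val volume) := by
              refine setLIntegral_mono measurable_const fun r hr => ?_
              have hr0 : (0 : ℝ) < r := r.2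
              have := hR _ ((hmem r).1 hr)
              rw [norm_smul, he, mul_one, Real.norm_of_nonneg hr0.le] at this
              exact ENNReal.ofReal_le_ofReal (pow_le_pow_left₀ hr0.le this d)
          _ = ENNReal.ofReal (R ^ d) * volume ((↑) '' W : Set ℝ) := by
              rw [setLIntegral_const, comap_subtype_coe_apply measurableSet_Ioi]
          _ ≤ _ := by
              gcongr
              refine (measure_mono ?_).trans (h e he)
              rintro _ ⟨r, hr, rfl⟩
              exact ⟨r.2, (hmem r).1 hr⟩
    _ = _ := by rw [lintegral_const, mul_comm]

/-! ### Intersection of two thin annuli in three dimensions -/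

theorem volume_planar_annulus_le (γ : ℝ) {l : ℝ} (hl : 0 ≤ l) :
    volume {y : EuclideanSpace ℝ (Fin 2) | γ ≤ ‖y‖ ^ 2 ∧ ‖y‖ ^ 2 ≤ γ + l}
      ≤ ENNReal.ofReal (Real.pi * l) := by
  rcases lt_or_ge (γ + l) 0 with hneg | hpos
  · have : {y : EuclideanSpace ℝ (Fin 2) | γ ≤ ‖y‖ ^ 2 ∧ ‖y‖ ^ 2 ≤ γ + l} = ∅ := by
      ext y
      simp only [Set.mem_ofPred_eq, Set.mem_empty_iff_false, iff_false, not_and, not_le]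
      intro _
      exact hneg.trans_le (sq_nonneg _)
    simp [this]
  have hsub : {y : EuclideanSpace ℝ (Fin 2) | γ ≤ ‖y‖ ^ 2 ∧ ‖y‖ ^ 2 ≤ γ + l}
      ⊆ Metric.closedBall 0 √(γ + l) \ Metric.ball 0 √γ := by
    rintro y ⟨h1, h2⟩
    simp only [Set.mem_sdiff, mem_closedBall_zero_iff, mem_ball_zero_iff, not_lt]
    exact ⟨Real.le_sqrt_of_sq_le h2, Real.sqrt_le_iff.2 ⟨norm_nonneg _, h1⟩⟩
  have hball : Metric.ball (0 : EuclideanSpace ℝ (Fin 2)) √γ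
      ⊆ Metric.closedBall 0 √(γ + l) :=
    Metric.ball_subset_closedBall.trans
      (Metric.closedBall_subset_closedBall (Real.sqrt_le_sqrt (by linarith)))
  refine (measure_mono hsub).trans ?_
  rw [measure_sdiff hball measurableSet_ball.nullMeasurableSet measure_ball_lt_top.ne,
    EuclideanSpace.volume_closedBall_fin_two, EuclideanSpace.volume_ball_fin_two,
    ← ENNReal.ofReal_pow (Real.sqrt_nonneg _), ← ENNReal.ofReal_pow (Real.sqrt_nonneg _),
    Real.sq_sqrt hpos]
  rw [← ENNReal.ofReal_mul hpos, ← ENNReal.ofReal_mul (sq_nonneg _),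
    ← ENNReal.ofReal_sub _ (by positivity)]
  refine ENNReal.ofReal_le_ofReal ?_
  have : γ ≤ √γ ^ 2 := by
    rcases le_total 0 γ with h | h
    · rw [Real.sq_sqrt h]
    · exact h.trans (sq_nonneg _)
  nlinarith [Real.pi_pos]

/-- Archimedes' hat-box principle: each horizontal slice is a planar annulus of area at most `π *
l`, independently of its height. -/
theorem volume_coordinate_slab_le (α β : ℝ) {l m : ℝ} (hl : 0 ≤ l) :
    volume {z : EuclideanSpace ℝ (Fin 3) | (α ≤ ‖z‖ ^ 2 ∧ ‖z‖ ^ 2 ≤ α + l) ∧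
      (β ≤ z 0 ∧ z 0 ≤ β + m)} ≤ ENNReal.ofReal (Real.pi * l * m) := by
  set S := {z : EuclideanSpace ℝ (Fin 3) | (α ≤ ‖z‖ ^ 2 ∧ ‖z‖ ^ 2 ≤ α + l) ∧
      (β ≤ z 0 ∧ z 0 ≤ β + m)} with hSdef
  have hS : MeasurableSet S := by
    have h0 : Continuous fun z : EuclideanSpace ℝ (Fin 3) => z 0 := by fun_prop
    have h1 : Continuous fun z : EuclideanSpace ℝ (Fin 3) => ‖z‖ ^ 2 := by fun_prop
    exact ((isClosed_Icc (a := α) (b := α + l)).preimage h1).measurableSet.inter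
      ((isClosed_Icc (a := β) (b := β + m)).preimage h0).measurableSet
  have hmp := (PiLp.volume_preserving_toLp (Fin 3)).comp
    ((volume_preserving_piFinSuccAbove (fun _ : Fin 3 => ℝ) 0).symm _)
  rw [← hmp.measure_preimage hS.nullMeasurableSet]
  have hV := hmp.measurable hS
  have key : ∀ (z : ℝ) (y : Fin 2 → ℝ),
      ((WithLp.toLp 2 ∘ (MeasurableEquiv.piFinSuccAbove (fun _ : Fin 3 => ℝ) 0).symm) (z, y) ∈ S)
      ↔ (α ≤ z ^ 2 + ‖WithLp.toLp 2 y‖ ^ 2 ∧ z ^ 2 + ‖WithLp.toLp 2 y‖ ^ 2 ≤ α + l) ∧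
        (β ≤ z ∧ z ≤ β + m) := by
    intro z y
    have h2 : (Fin.cons z y : Fin 3 → ℝ) 2 = y 1 := rfl
    simp [hSdef, EuclideanSpace.norm_sq_eq, Fin.sum_univ_succ, MeasurableEquiv.piFinSuccAbove,
      Fin.insertNthEquiv, sq_abs, h2]
  rw [Measure.volume_eq_prod, Measure.prod_apply hV]
  have hslice : ∀ z : ℝ, volume (Prod.mk z ⁻¹' ((WithLp.toLp 2 ∘
      (MeasurableEquiv.piFinSuccAbove (fun _ : Fin 3 => ℝ) 0).symm) ⁻¹' S))
      ≤ (Set.Icc β (β + m)).indicator (fun _ => ENNReal.ofReal (Real.pi * l)) z := by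
    intro z
    by_cases hz : z ∈ Set.Icc β (β + m)
    · rw [Set.indicator_of_mem hz]
      refine le_trans (le_of_eq ?_) (volume_planar_annulus_le (α - z ^ 2) hl)
      have hms : MeasurableSet {y : EuclideanSpace ℝ (Fin 2) |
          α - z ^ 2 ≤ ‖y‖ ^ 2 ∧ ‖y‖ ^ 2 ≤ α - z ^ 2 + l} :=
        ((isClosed_Icc (a := α - z ^ 2) (b := α - z ^ 2 + l)).preimage
          (continuous_norm.pow 2)).measurableSet
      rw [← (PiLp.volume_preserving_toLp (Fin 2)).measure_preimage hms.nullMeasurableSet]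
      congr 1
      ext y
      rw [Set.mem_preimage, Set.mem_preimage, key]
      simp only [Set.mem_preimage, Set.mem_ofPred_eq]
      have := hz.1
      have := hz.2
      constructor
      · rintro ⟨⟨h1, h2⟩, _⟩
        exact ⟨by linarith, by linarith⟩
      · rintro ⟨h1, h2⟩
        exact ⟨⟨by linarith, by linarith⟩, by assumption, by assumption⟩
    · rw [Set.indicator_of_notMem hz, nonpos_iff_eq_zero]
      convert measure_empty (μ := (volume : Measure (Fin 2 → ℝ)))
      ext y
      rw [Set.mem_preimage, Set.mem_preimage, key]
      simp only [Set.mem_empty_iff_false, iff_false]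
      exact fun h => hz h.2
  refine (lintegral_mono hslice).trans ?_
  rw [lintegral_indicator measurableSet_Icc, setLIntegral_const, Real.volume_Icc,
    ← ENNReal.ofReal_mul (by positivity)]
  simp

theorem volume_spherical_slab_le {u : EuclideanSpace ℝ (Fin 3)} (hu : ‖u‖ = 1) (α β : ℝ)
    {l m : ℝ} (hl : 0 ≤ l) :
    volume {z : EuclideanSpace ℝ (Fin 3) | (α ≤ ‖z‖ ^ 2 ∧ ‖z‖ ^ 2 ≤ α + l) ∧
      (β ≤ inner ℝ u z ∧ inner ℝ u z ≤ β + m)} ≤ ENNReal.ofReal (Real.pi * l * m) := by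
  obtain ⟨b, hb⟩ := Orthonormal.exists_orthonormalBasis_extension_of_card_eq (𝕜 := ℝ)
    (ι := Fin 3) (by simp) (v := fun _ : Fin 3 => u) (s := {0}) (by
      rw [orthonormal_iff_ite]
      rintro ⟨i, hi⟩ ⟨j, hj⟩
      obtain rfl : i = 0 := hi
      obtain rfl : j = 0 := hj
      simp [hu])
  have hb0 : b 0 = u := hb 0 rfl
  refine le_trans (le_of_eq ?_) (volume_coordinate_slab_le α β hl)
  refine Eq.trans ?_ (b.measurePreserving_repr.measure_preimage_equiv
    (f := b.repr.toHomeomorph.toMeasurableEquiv) _)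
  congr 1
  ext z
  have hz : inner ℝ u z = b.repr z 0 := by rw [OrthonormalBasis.repr_apply_apply, hb0]
  simp [hz]

/-- `‖x - a‖² - ‖x - b‖²` is affine in `x` with gradient of length `2 * dist a b`, so the second
annulus confines the first to a slab orthogonal to `b - a`. -/
theorem volume_inter_annuli_le {a b : EuclideanSpace ℝ (Fin 3)} (hab : a ≠ b) {r s δ : ℝ}
    (hr : 0 ≤ r) (hr2 : r ≤ 2) (hs : 0 ≤ s) (hs2 : s ≤ 2) (hδ : 0 ≤ δ) (hδ1 : δ ≤ 1) :
    volume ({x | r < dist x a ∧ dist x a < r + δ} ∩ {x | s < dist x b ∧ dist x b < s + δ})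
      ≤ ENNReal.ofReal (25 * Real.pi * δ ^ 2 / dist a b) := by
  have hD : 0 < dist a b := dist_pos.2 hab
  set D := dist a b with hDdef
  set u : EuclideanSpace ℝ (Fin 3) := D⁻¹ • (b - a) with hudef
  have hba : ‖b - a‖ = D := by rw [hDdef, dist_comm, dist_eq_norm]
  have hu : ‖u‖ = 1 := by
    rw [hudef, norm_smul, hba, norm_inv, Real.norm_of_nonneg hD.le, inv_mul_cancel₀ hD.ne']
  -- Since `r ≤ 2` and `δ ≤ 1`, `(r + δ) ^ 2 ≤ r ^ 2 + 5 * δ`; likewise for `s`. The difference of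
  -- squares thus varies by `10 * δ`, giving slab width `10 * δ / (2 * D)`.
  have hslab := volume_spherical_slab_le hu (r ^ 2) ((r ^ 2 - (s ^ 2 + 5 * δ) + D ^ 2) / (2 * D))
    (l := 5 * δ) (m := 5 * δ / D) (by positivity)
  rw [show Real.pi * (5 * δ) * (5 * δ / D) = 25 * Real.pi * δ ^ 2 / D by ring] at hslab
  refine le_trans ?_ hslab
  rw [← measure_preimage_add_right volume (-a) {z : EuclideanSpace ℝ (Fin 3) | _ ∧ _}]
  refine measure_mono ?_
  rintro x ⟨⟨h1, h2⟩, h3, h4⟩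
  rw [dist_eq_norm] at h1 h2 h3 h4
  simp only [Set.mem_preimage, Set.mem_ofPred_eq, ← sub_eq_add_neg]
  have hxb : x - b = (x - a) - (b - a) := by abel
  have hsq : ‖x - b‖ ^ 2 = ‖x - a‖ ^ 2 - 2 * inner ℝ (x - a) (b - a) + D ^ 2 := by
    rw [hxb, norm_sub_sq_real, hba]
  have hin : inner ℝ u (x - a) = (‖x - a‖ ^ 2 - ‖x - b‖ ^ 2 + D ^ 2) / (2 * D) := by
    rw [hsq, hudef, inner_smul_left, real_inner_comm]
    simp only [conj_trivial]
    field_simp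
    ring
  have e1 : r ^ 2 ≤ ‖x - a‖ ^ 2 := pow_le_pow_left₀ hr h1.le 2
  have e2 : ‖x - a‖ ^ 2 ≤ r ^ 2 + 5 * δ := by nlinarith [norm_nonneg (x - a)]
  have e3 : s ^ 2 ≤ ‖x - b‖ ^ 2 := pow_le_pow_left₀ hs h3.le 2
  have e4 : ‖x - b‖ ^ 2 ≤ s ^ 2 + 5 * δ := by nlinarith [norm_nonneg (x - b)]
  refine ⟨⟨e1, e2⟩, ?_, ?_⟩
  · rw [hin]
    gcongr
  · rw [hin, show (r ^ 2 - (s ^ 2 + 5 * δ) + D ^ 2) / (2 * D) + 5 * δ / D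
      = (r ^ 2 + 5 * δ - s ^ 2 + D ^ 2) / (2 * D) by field_simp; ring]
    gcongr

/-! ### Second moments and the lower bound -/

/-- Cauchy–Schwarz for the counting function `N = ∑ 1_{A i}`, obtained by integrating `2 * t * N - N
^ 2 ≤ t ^ 2 * 1_U` at the best choice `t = B / a`. -/
theorem sq_div_le_measureReal_of_sum_inter_le {α : Type*} [MeasurableSpace α] {μ : Measure α}
    {n : ℕ} {A : ℕ → Set α} {U : Set α} (hA : ∀ i, MeasurableSet (A i)) (hU : MeasurableSet U)
    (hAU : ∀ i < n, A i ⊆ U) (hμU : μ U ≠ ⊤) {a B : ℝ} (hB : 0 < B) (ha : 0 ≤ a)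
    (h1 : a ≤ ∑ i ∈ Finset.range n, μ.real (A i))
    (h2 : ∑ i ∈ Finset.range n, ∑ j ∈ Finset.range n, μ.real (A i ∩ A j) ≤ B) :
    a ^ 2 / B ≤ μ.real U := by
  rcases ha.eq_or_lt with rfl | ha
  · simp
  set t := B / a with ht
  have ht0 : 0 < t := div_pos hB ha
  have hfin : ∀ i < n, μ (A i) ≠ ⊤ := fun i hi => measure_ne_top_of_subset (hAU i hi) hμU
  have hpt : ∀ x, 2 * t * ∑ i ∈ Finset.range n, (A i).indicator (fun _ => (1 : ℝ)) x
      - ∑ i ∈ Finset.range n, ∑ j ∈ Finset.range n, (A i ∩ A j).indicator (fun _ => (1 : ℝ)) x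
      ≤ t ^ 2 * U.indicator (fun _ => (1 : ℝ)) x := by
    intro x
    have hsq : ∑ i ∈ Finset.range n, ∑ j ∈ Finset.range n,
        (A i ∩ A j).indicator (fun _ => (1 : ℝ)) x
        = (∑ i ∈ Finset.range n, (A i).indicator (fun _ => (1 : ℝ)) x) ^ 2 := by
      rw [sq, Finset.sum_mul_sum]
      refine Finset.sum_congr rfl fun i _ => Finset.sum_congr rfl fun j _ => ?_
      by_cases hi : x ∈ A i <;> by_cases hj : x ∈ A j <;> simp [hi, hj]
    rw [hsq]
    by_cases hx : x ∈ U
    · rw [Set.indicator_of_mem hx]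
      nlinarith [sq_nonneg (t - ∑ i ∈ Finset.range n, (A i).indicator (fun _ => (1 : ℝ)) x)]
    · have h0 : ∑ i ∈ Finset.range n, (A i).indicator (fun _ => (1 : ℝ)) x = 0 :=
        Finset.sum_eq_zero fun i hi => Set.indicator_of_notMem
          (fun h => hx (hAU i (Finset.mem_range.1 hi) h)) _
      simp [h0, hx]
  have hint : ∀ i ∈ Finset.range n, Integrable ((A i).indicator fun _ => (1 : ℝ)) μ :=
    fun i hi => (integrable_indicator_iff (hA i)).2
      (integrableOn_const (hfin i (Finset.mem_range.1 hi)))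
  have hint2 : ∀ i ∈ Finset.range n, ∀ j ∈ Finset.range n,
      Integrable ((A i ∩ A j).indicator fun _ => (1 : ℝ)) μ :=
    fun i hi j _ => (integrable_indicator_iff ((hA i).inter (hA j))).2
      (integrableOn_const (measure_ne_top_of_subset Set.inter_subset_left
        (hfin i (Finset.mem_range.1 hi))))
  have hintU : Integrable (U.indicator fun _ => (1 : ℝ)) μ :=
    (integrable_indicator_iff hU).2 (integrableOn_const hμU)
  have hI1 := integrable_finsetSum (Finset.range n) hint
  have hI2 := integrable_finsetSum (Finset.range n)
    fun i hi => integrable_finsetSum (Finset.range n) (hint2 i hi)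
  have hval : ∀ S : Set α, MeasurableSet S → ∫ x, S.indicator (fun _ => (1 : ℝ)) x ∂μ = μ.real S :=
    fun S hS => integral_indicator_one hS
  have key := integral_mono ((hI1.const_mul (2 * t)).sub hI2) (hintU.const_mul (t ^ 2)) hpt
  have e1 : ∫ x, (2 * t * ∑ i ∈ Finset.range n, (A i).indicator (fun _ => (1 : ℝ)) x
      - ∑ i ∈ Finset.range n, ∑ j ∈ Finset.range n, (A i ∩ A j).indicator (fun _ => (1 : ℝ)) x) ∂μ
      = 2 * t * ∑ i ∈ Finset.range n, μ.real (A i)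
        - ∑ i ∈ Finset.range n, ∑ j ∈ Finset.range n, μ.real (A i ∩ A j) := by
    rw [integral_sub (hI1.const_mul (2 * t)) hI2, integral_const_mul, integral_finsetSum _ hint,
      integral_finsetSum _ fun i hi => integrable_finsetSum (Finset.range n) (hint2 i hi)]
    congr 1
    · exact congrArg _ (Finset.sum_congr rfl fun i _ => hval _ (hA i))
    · refine Finset.sum_congr rfl fun i hi => ?_
      rw [integral_finsetSum _ (hint2 i hi)]
      exact Finset.sum_congr rfl fun j _ => hval _ ((hA i).inter (hA j))
  have e2 : ∫ x, t ^ 2 * U.indicator (fun _ => (1 : ℝ)) x ∂μ = t ^ 2 * μ.real U := by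
    rw [integral_const_mul, hval U hU]
  have key' : 2 * t * a - B ≤ t ^ 2 * μ.real U := by
    have : 2 * t * a ≤ 2 * t * ∑ i ∈ Finset.range n, μ.real (A i) := by gcongr
    rw [← e2]
    refine le_trans ?_ key
    refine le_trans ?_ (le_of_eq e1.symm)
    linarith
  have hta : t * a = B := by rw [ht]; field_simp
  have : a ^ 2 / B = (2 * t * a - B) / t ^ 2 := by
    rw [show 2 * t * a - B = B by linarith, ht]
    field_simp
  rw [this, div_le_iff₀ (by positivity)]
  linarith

theorem sum_inv_abs_sub_add_one_le {n i : ℕ} (hi : i < n) :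
    ∑ j ∈ Finset.range n, (|(i : ℝ) - j| + 1)⁻¹ ≤ 2 * (1 + Real.log n) := by
  have hmono : ∀ m ≤ n, ∑ k ∈ Finset.range m, ((k : ℝ) + 1)⁻¹ ≤ 1 + Real.log n := by
    intro m hm
    have h := harmonic_le_one_add_log n
    rw [harmonic] at h
    push_cast at h
    refine le_trans ?_ h
    exact Finset.sum_le_sum_of_subset_of_nonneg (Finset.range_mono hm)
      fun _ _ _ => by positivity
  obtain ⟨m, rfl⟩ := Nat.exists_eq_add_of_lt hi
  rw [show i + m + 1 = (i + 1) + m by ring] at hmono ⊢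
  rw [Finset.sum_range_add]
  have h1 : ∑ j ∈ Finset.range (i + 1), (|(i : ℝ) - j| + 1)⁻¹
      = ∑ k ∈ Finset.range (i + 1), ((k : ℝ) + 1)⁻¹ := by
    rw [← Finset.sum_range_reflect]
    refine Finset.sum_congr rfl fun k hk => ?_
    have hk' : k ≤ i := Nat.lt_succ_iff.1 (Finset.mem_range.1 hk)
    rw [show i + 1 - 1 - k = i - k by omega, Nat.cast_sub hk']
    simp
  have h2 : ∑ j ∈ Finset.range m, (|(i : ℝ) - ((i + 1 + j : ℕ) : ℝ)| + 1)⁻¹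
      ≤ ∑ k ∈ Finset.range m, ((k : ℝ) + 1)⁻¹ := by
    refine Finset.sum_le_sum fun k _ => ?_
    have : |(i : ℝ) - ((i + 1 + k : ℕ) : ℝ)| = k + 1 := by
      push_cast
      rw [show (i : ℝ) - (i + 1 + k) = -(k + 1) by ring, abs_neg, abs_of_nonneg (by positivity)]
    rw [this]
    gcongr
    linarith
  rw [h1]
  linarith [hmono (i + 1) (by omega), hmono m (by omega)]

theorem annulus_subset_thickening_sphere {E : Type*} [NormedAddCommGroup E] [NormedSpace ℝ E]
    {c : E} {r δ : ℝ} (hr : 0 < r) :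
    {x | r < dist x c ∧ dist x c < r + δ} ⊆ Metric.thickening δ (Metric.sphere c r) := by
  rintro x ⟨h1, h2⟩
  have hx : 0 < ‖x - c‖ := by rw [← dist_eq_norm]; linarith
  rw [Metric.mem_thickening_iff]
  refine ⟨c + (r / ‖x - c‖) • (x - c), ?_, ?_⟩
  · rw [mem_sphere_iff_norm, add_sub_cancel_left, norm_smul, Real.norm_of_nonneg (by positivity),
      div_mul_cancel₀ _ hx.ne']
  · have : x - (c + (r / ‖x - c‖) • (x - c)) = (1 - r / ‖x - c‖) • (x - c) := by
      rw [sub_smul, one_smul]; abel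
    rw [dist_eq_norm] at h1 h2 ⊢
    rw [this, norm_smul, Real.norm_of_nonneg
      (by rw [sub_nonneg, div_le_one hx]; exact h1.le), sub_mul, div_mul_cancel₀ _ hx.ne']
    linarith

theorem volumeReal_annulus_fin_three (c : EuclideanSpace ℝ (Fin 3)) {r δ : ℝ} (hr : 0 ≤ r)
    (hδ : 0 < δ) :
    volume.real {x | r < dist x c ∧ dist x c < r + δ}
      = 4 * Real.pi / 3 * ((r + δ) ^ 3 - r ^ 3) := by
  have : {x | r < dist x c ∧ dist x c < r + δ}
      = Metric.ball c (r + δ) \ Metric.closedBall c r := by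
    ext x
    simp [and_comm]
  rw [this, measureReal_sdiff (Metric.closedBall_subset_ball (by linarith)) measurableSet_closedBall
    measure_ball_lt_top.ne, measureReal_def, measureReal_def, EuclideanSpace.volume_ball_fin_three,
    EuclideanSpace.volume_closedBall_fin_three]
  have hp := Real.pi_pos
  simp only [ENNReal.toReal_mul, ENNReal.toReal_pow, ENNReal.toReal_ofReal hr,
    ENNReal.toReal_ofReal (show 0 ≤ r + δ by linarith),
    ENNReal.toReal_ofReal (show 0 ≤ Real.pi * 4 / 3 by positivity)]
  ring

theorem volumeReal_inter_separated_annuli_le {δ : ℝ} (hδ : 0 < δ) {n : ℕ} (hn : n * δ ≤ 1)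
    (c : ℕ → EuclideanSpace ℝ (Fin 3)) {i j : ℕ} (hi : i < n) (hj : j < n) :
    volume.real ({x | 1 + i * δ < dist x (c i) ∧ dist x (c i) < 1 + i * δ + δ} ∩
      {x | 1 + j * δ < dist x (c j) ∧ dist x (c j) < 1 + j * δ + δ})
      ≤ 50 * Real.pi * δ * (|(i : ℝ) - j| + 1)⁻¹ := by
  have hp := Real.pi_pos
  have hbd : ∀ k < n, (k : ℝ) * δ + δ ≤ 1 := fun k hk => by
    have : ((k : ℝ) + 1) ≤ n := by exact_mod_cast hk
    nlinarith
  have hi' := hbd i hi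
  have hj' := hbd j hj
  have hiδ : 0 ≤ (i : ℝ) * δ := by positivity
  have hjδ : 0 ≤ (j : ℝ) * δ := by positivity
  set k := |(i : ℝ) - j| with hk
  have hk0 : 0 ≤ k := abs_nonneg _
  rw [← div_eq_mul_inv]
  -- For `k ≥ 3` the triangle inequality gives centre distance at least `δ * (k - 1) ≥ δ * (k + 1) /
  -- 2`. For `k ≤ 2` the volume of one annulus, at most `16 * π * δ`, is enough.
  rcases lt_or_ge k 3 with hlt | hge
  · have hk2 : k ≤ 2 := by
      have h3 : |(i : ℤ) - j| < 3 := by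
        have : ((|(i : ℤ) - j| : ℤ) : ℝ) < (3 : ℤ) := by push_cast; exact hlt
        exact_mod_cast this
      have := Int.cast_le (R := ℝ).2 (Int.le_of_lt_add_one (b := 2) h3)
      push_cast at this
      exact this
    refine (measureReal_mono Set.inter_subset_left ?_).trans ?_
    · exact measure_ne_top_of_subset (fun x hx => Metric.mem_ball.2 hx.2)
        (measure_ball_lt_top (x := c i) (r := 1 + i * δ + δ)).ne
    rw [volumeReal_annulus_fin_three _ (by positivity) hδ, le_div_iff₀ (by positivity)]
    set r := 1 + (i : ℝ) * δ with hr
    have h12 : (r + δ) ^ 3 - r ^ 3 ≤ 12 * δ := by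
      have e : (r + δ) ^ 3 - r ^ 3 = δ * ((r + δ) ^ 2 + (r + δ) * r + r ^ 2) := by ring
      have : (r + δ) ^ 2 + (r + δ) * r + r ^ 2 ≤ 12 := by nlinarith
      rw [e]; nlinarith
    calc 4 * Real.pi / 3 * ((r + δ) ^ 3 - r ^ 3) * (k + 1)
        ≤ 4 * Real.pi / 3 * (12 * δ) * (2 + 1) := by gcongr
      _ ≤ _ := by nlinarith [mul_pos hp hδ]
  · by_cases hne : ({x | 1 + i * δ < dist x (c i) ∧ dist x (c i) < 1 + i * δ + δ} ∩
      {x | 1 + j * δ < dist x (c j) ∧ dist x (c j) < 1 + j * δ + δ}).Nonempty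
    · obtain ⟨x, ⟨h1, h2⟩, h3, h4⟩ := hne
      have hd : δ * (k + 1) / 2 ≤ dist (c i) (c j) := by
        have ht1 := dist_triangle x (c i) (c j)
        have ht2 := dist_triangle x (c j) (c i)
        rw [dist_comm (c j)] at ht2
        have : δ * k - δ ≤ dist (c i) (c j) := by
          rcases abs_cases ((i : ℝ) - j) with ⟨h, _⟩ | ⟨h, _⟩ <;> rw [hk, h] <;> nlinarith
        nlinarith
      have hd0 : 0 < dist (c i) (c j) := lt_of_lt_of_le (by positivity) hd
      refine ENNReal.toReal_le_of_le_ofReal (by positivity)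
        ((volume_inter_annuli_le (dist_pos.1 hd0) (by positivity) (by linarith) (by positivity)
          (by linarith) hδ.le (by linarith)).trans (ENNReal.ofReal_le_ofReal ?_))
      calc 25 * Real.pi * δ ^ 2 / dist (c i) (c j)
          ≤ 25 * Real.pi * δ ^ 2 / (δ * (k + 1) / 2) := by gcongr
        _ = _ := by field_simp; ring
    · rw [Set.not_nonempty_iff_eq_empty.1 hne, measureReal_empty]
      positivity

theorem volume_thickening_ge_of_containsAllSpheres {δ : ℝ} (hδ : 0 < δ) (hδ2 : δ ≤ 1 / 2)
    {K : Set (EuclideanSpace ℝ (Fin (2 + 1)))} (hK : IsCompact K)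
    (hKs : ContainsAllSpheres 2 K) :
    ENNReal.ofReal (Real.pi / 75 * |Real.log δ| ^ (-1 : ℝ)) ≤ volume (Metric.thickening δ K) := by
  have hp := Real.pi_pos
  set n := ⌊1 / δ⌋₊ with hn
  have hnδ : n * δ ≤ 1 := by
    have := Nat.floor_le (show 0 ≤ 1 / δ by positivity)
    rwa [le_div_iff₀ hδ] at this
  have hnδ2 : 1 / 2 ≤ n * δ := by
    have := Nat.lt_floor_add_one (1 / δ)
    rw [div_lt_iff₀ hδ] at this
    linarith
  have hn0 : 0 < n := by
    rcases Nat.eq_zero_or_pos n with h | h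
    · rw [h] at hnδ2; norm_num at hnδ2
    · exact h
  have hbd : ∀ k < n, (k : ℝ) * δ + δ ≤ 1 := fun k hk => by
    have : ((k : ℝ) + 1) ≤ n := by exact_mod_cast hk
    nlinarith
  have hex : ∀ i : ℕ, ∃ c : EuclideanSpace ℝ (Fin 3),
      i < n → Metric.sphere c (1 + i * δ) ⊆ K := by
    intro i
    by_cases hi : i < n
    · obtain ⟨c, hc⟩ := hKs (1 + i * δ) ⟨by nlinarith [show 0 ≤ (i : ℝ) * δ by positivity],
        by linarith [hbd i hi]⟩
      exact ⟨c, fun _ => hc⟩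
    · exact ⟨0, fun h => absurd h hi⟩
  choose c hc using hex
  set A : ℕ → Set (EuclideanSpace ℝ (Fin 3)) := fun i =>
    {x | 1 + i * δ < dist x (c i) ∧ dist x (c i) < 1 + i * δ + δ} with hA
  have hAm : ∀ i, MeasurableSet (A i) := fun i =>
    (isOpen_Ioo.preimage (f := fun x => dist x (c i)) (by fun_prop)).measurableSet
  have hAU : ∀ i < n, A i ⊆ Metric.thickening δ K := fun i hi =>
    (annulus_subset_thickening_sphere (by positivity)).trans
      (Metric.thickening_subset_of_subset δ (hc i hi))
  have hfin : volume (Metric.thickening δ K) ≠ ⊤ :=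
    hK.isBounded.thickening.measure_lt_top.ne
  set Λ := |Real.log δ| with hΛ
  have hΛeq : Λ = Real.log (1 / δ) := by
    rw [hΛ, abs_of_neg (Real.log_neg hδ (by linarith)), one_div, Real.log_inv]
  -- This turns `1 + log n` into at most `3 * Λ`.
  have hΛ2 : 1 / 2 ≤ Λ := by
    have : Real.log 2 ≤ Real.log (1 / δ) :=
      Real.log_le_log (by norm_num) (by rw [le_div_iff₀ hδ]; linarith)
    rw [hΛeq]
    linarith [Real.log_two_gt_d9]
  have hlogn : Real.log n ≤ Λ := by
    rw [hΛeq]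
    exact Real.log_le_log (by exact_mod_cast hn0) (by rwa [le_div_iff₀ hδ])
  have h1 : 2 * Real.pi ≤ ∑ i ∈ Finset.range n, volume.real (A i) := by
    have : ∀ i ∈ Finset.range n, 4 * Real.pi * δ ≤ volume.real (A i) := by
      intro i _
      rw [hA, volumeReal_annulus_fin_three _ (by positivity) hδ]
      set r := 1 + (i : ℝ) * δ with hr
      have hr1 : 1 ≤ r := by nlinarith [show 0 ≤ (i : ℝ) * δ by positivity]
      have e : (r + δ) ^ 3 - r ^ 3 = δ * ((r + δ) ^ 2 + (r + δ) * r + r ^ 2) := by ring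
      have : 3 ≤ (r + δ) ^ 2 + (r + δ) * r + r ^ 2 := by nlinarith
      have : δ * 3 ≤ (r + δ) ^ 3 - r ^ 3 := by rw [e]; gcongr
      calc 4 * Real.pi * δ = 4 * Real.pi / 3 * (δ * 3) := by ring
        _ ≤ _ := by gcongr
    calc 2 * Real.pi ≤ n * (4 * Real.pi * δ) := by nlinarith
      _ ≤ _ := by
        have := Finset.card_nsmul_le_sum _ _ _ this
        rwa [Finset.card_range, nsmul_eq_mul] at this
  have h2 : ∑ i ∈ Finset.range n, ∑ j ∈ Finset.range n, volume.real (A i ∩ A j)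
      ≤ 300 * Real.pi * Λ := by
    have : ∀ i ∈ Finset.range n, ∑ j ∈ Finset.range n, volume.real (A i ∩ A j)
        ≤ 50 * Real.pi * δ * (2 * (3 * Λ)) := by
      intro i hi
      have hi := Finset.mem_range.1 hi
      calc ∑ j ∈ Finset.range n, volume.real (A i ∩ A j)
          ≤ ∑ j ∈ Finset.range n, 50 * Real.pi * δ * (|(i : ℝ) - j| + 1)⁻¹ :=
            Finset.sum_le_sum fun j hj => volumeReal_inter_separated_annuli_le hδ hnδ c hi
              (Finset.mem_range.1 hj)
        _ = 50 * Real.pi * δ * ∑ j ∈ Finset.range n, (|(i : ℝ) - j| + 1)⁻¹ := by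
            rw [Finset.mul_sum]
        _ ≤ 50 * Real.pi * δ * (2 * (3 * Λ)) := by
            gcongr
            refine (sum_inv_abs_sub_add_one_le hi).trans ?_
            linarith
    calc _ ≤ n * (50 * Real.pi * δ * (2 * (3 * Λ))) := by
          have := Finset.sum_le_card_nsmul _ _ _ this
          rwa [Finset.card_range, nsmul_eq_mul] at this
      _ = 300 * Real.pi * Λ * (n * δ) := by ring
      _ ≤ 300 * Real.pi * Λ * 1 := by gcongr
      _ = _ := mul_one _
  have key := sq_div_le_measureReal_of_sum_inter_le hAm Metric.isOpen_thickening.measurableSet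
    hAU hfin (by positivity) (by positivity) h1 h2
  rw [Real.rpow_neg_one]
  refine (ENNReal.ofReal_le_iff_le_toReal hfin).2 (le_trans (le_of_eq ?_) key)
  -- The constant is `(2 * π) ^ 2 / (300 * π) = π / 75`.
  field_simp
  norm_num

/-! ### Dense closed walks on spheres, by suspension -/

/-- The vector with first coordinate `a` followed by the coordinates of `v`. -/
def euclideanCons {n : ℕ} (a : ℝ) (v : EuclideanSpace ℝ (Fin n)) :
    EuclideanSpace ℝ (Fin (n + 1)) :=
  WithLp.toLp 2 (Fin.cons a v.ofLp)

theorem norm_sq_euclideanCons {n : ℕ} (a : ℝ) (v : EuclideanSpace ℝ (Fin n)) :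
    ‖euclideanCons a v‖ ^ 2 = a ^ 2 + ‖v‖ ^ 2 := by
  simp [euclideanCons, EuclideanSpace.norm_sq_eq, Fin.sum_univ_succ]

theorem euclideanCons_sub {n : ℕ} (a b : ℝ) (v u : EuclideanSpace ℝ (Fin n)) :
    euclideanCons a v - euclideanCons b u = euclideanCons (a - b) (v - u) := by
  ext i
  refine Fin.cases ?_ (fun i => ?_) i <;> simp [euclideanCons]

theorem norm_euclideanCons_le {n : ℕ} (a : ℝ) (v : EuclideanSpace ℝ (Fin n)) :
    ‖euclideanCons a v‖ ≤ |a| + ‖v‖ := by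
  refine le_of_sq_le_sq ?_ (by positivity)
  rw [norm_sq_euclideanCons, ← sq_abs a]
  nlinarith [mul_nonneg (abs_nonneg a) (norm_nonneg v)]

/-- The point at polar angle `α` on the meridian through `v` of the sphere of one dimension
higher. -/
noncomputable def suspensionPoint {n : ℕ} (α : ℝ) (v : EuclideanSpace ℝ (Fin n)) :
    EuclideanSpace ℝ (Fin (n + 1)) :=
  euclideanCons (Real.cos α) (Real.sin α • v)

theorem norm_suspensionPoint {n : ℕ} (α : ℝ) {v : EuclideanSpace ℝ (Fin n)} (hv : ‖v‖ = 1) :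
    ‖suspensionPoint α v‖ = 1 := by
  have : ‖suspensionPoint α v‖ ^ 2 = 1 := by
    rw [suspensionPoint, norm_sq_euclideanCons, norm_smul, hv, mul_one, Real.norm_eq_abs, sq_abs,
      Real.cos_sq_add_sin_sq]
  nlinarith [norm_nonneg (suspensionPoint α v)]

theorem norm_suspensionPoint_sub_le {n : ℕ} (α β : ℝ) {v u : EuclideanSpace ℝ (Fin n)}
    (hu : ‖u‖ = 1) :
    ‖suspensionPoint α v - suspensionPoint β u‖ ≤ 2 * |α - β| + ‖v - u‖ := by
  rw [suspensionPoint, suspensionPoint, euclideanCons_sub]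
  refine (norm_euclideanCons_le _ _).trans ?_
  have h1 : |Real.cos α - Real.cos β| ≤ |α - β| := Real.abs_cos_sub_cos_le α β
  have h2 : |Real.sin α - Real.sin β| ≤ |α - β| := Real.abs_sin_sub_sin_le α β
  have h3 : ‖Real.sin α • v - Real.sin β • u‖ ≤ ‖v - u‖ + |α - β| := by
    rw [show Real.sin α • v - Real.sin β • u
      = Real.sin α • (v - u) + (Real.sin α - Real.sin β) • u by
        rw [smul_sub, sub_smul]; abel]
    refine (norm_add_le _ _).trans ?_
    rw [norm_smul, norm_smul, hu, mul_one, Real.norm_eq_abs, Real.norm_eq_abs]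
    have := mul_le_mul_of_nonneg_right (Real.abs_sin_le_one α) (norm_nonneg (v - u))
    linarith
  linarith

theorem exists_eq_suspensionPoint {n : ℕ} {e : EuclideanSpace ℝ (Fin (n + 1))} (he : ‖e‖ = 1)
    {u : EuclideanSpace ℝ (Fin n)} (hu : ‖u‖ = 1) :
    ∃ v : EuclideanSpace ℝ (Fin n), ‖v‖ = 1 ∧
      ∃ β ∈ Set.Icc 0 Real.pi, e = suspensionPoint β v := by
  set a := e 0
  set v₀ : EuclideanSpace ℝ (Fin n) := WithLp.toLp 2 (fun i => e i.succ) with hv₀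
  have hcons : e = euclideanCons a v₀ := by
    ext i
    refine Fin.cases ?_ (fun i => ?_) i <;> simp [euclideanCons, a, v₀]
  have hsq : a ^ 2 + ‖v₀‖ ^ 2 = 1 := by
    rw [← norm_sq_euclideanCons, ← hcons, he, one_pow]
  have ha1 : -1 ≤ a := by nlinarith [sq_nonneg ‖v₀‖]
  have ha2 : a ≤ 1 := by nlinarith [sq_nonneg ‖v₀‖]
  have hsin : Real.sin (Real.arccos a) = ‖v₀‖ := by
    rw [Real.sin_arccos, show 1 - a ^ 2 = ‖v₀‖ ^ 2 by linarith, Real.sqrt_sq (norm_nonneg _)]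
  have hmem : Real.arccos a ∈ Set.Icc 0 Real.pi := ⟨Real.arccos_nonneg a, Real.arccos_le_pi a⟩
  -- At a pole the meridian is undetermined, and `u` supplies one.
  by_cases h0 : v₀ = 0
  · refine ⟨u, hu, _, hmem, ?_⟩
    rw [suspensionPoint, hsin, Real.cos_arccos ha1 ha2, hcons, h0]
    simp
  · have hn : ‖v₀‖ ≠ 0 := norm_ne_zero_iff.2 h0
    refine ⟨‖v₀‖⁻¹ • v₀, ?_, _, hmem, ?_⟩
    · rw [norm_smul, norm_inv, norm_norm, inv_mul_cancel₀ hn]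
    · rw [suspensionPoint, hsin, Real.cos_arccos ha1 ha2, smul_smul, mul_inv_cancel₀ hn, one_smul]
      exact hcons

theorem suspensionPoint_two_pi_sub_neg {n : ℕ} (β : ℝ) (v : EuclideanSpace ℝ (Fin n)) :
    suspensionPoint (2 * Real.pi - β) (-v) = suspensionPoint β v := by
  simp [suspensionPoint, Real.cos_two_pi_sub, Real.sin_two_pi_sub]

/-- `w` is a walk of period `N` on the unit sphere, with steps of length at most `ε`. -/
structure IsPeriodicWalk {E : Type*} [NormedAddCommGroup E] (N : ℕ) (ε : ℝ) (w : ℕ → E) :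
    Prop where
  norm_eq : ∀ j, ‖w j‖ = 1
  periodic : Function.Periodic w N
  step_le : ∀ j, ‖w (j + 1) - w j‖ ≤ ε

/-- A helix: the polar angle makes one full turn while `w` is traversed `M` times, advancing by `2 *
π / M` in each traversal. A full turn, rather than a half, closes the walk and meets the meridians
of both `v` and `-v`, so density of `w` up to sign is enough. -/
theorem IsPeriodicWalk.exists_suspension {n N M : ℕ} (hN : 1 ≤ N) (hM : 1 ≤ M) {C : ℝ}
    {w : ℕ → EuclideanSpace ℝ (Fin n)} (hw : IsPeriodicWalk N (C / M) w)
    (hdense : ∀ e, ‖e‖ = 1 → ∃ i, ‖e - w i‖ ≤ C / M ∨ ‖-e - w i‖ ≤ C / M) :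
    ∃ w' : ℕ → EuclideanSpace ℝ (Fin (n + 1)),
      IsPeriodicWalk (N * M) ((C + 4 * Real.pi) / M) w' ∧
      ∀ e, ‖e‖ = 1 → ∃ i, ‖e - w' i‖ ≤ (C + 4 * Real.pi) / M := by
  have hp := Real.pi_pos
  have hM0 : (0 : ℝ) < M := by exact_mod_cast hM
  have hN0 : (0 : ℝ) < N := by exact_mod_cast hN
  set θ : ℕ → ℝ := fun j => 2 * Real.pi * j / (N * M) with hθ
  refine ⟨fun j => suspensionPoint (θ j) (w j), ⟨fun j => norm_suspensionPoint _ (hw.norm_eq j),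
    fun j => ?_, fun j => ?_⟩, fun e he => ?_⟩
  · have h1 : w (j + N * M) = w j := by
      have := hw.periodic.nat_mul M j
      rwa [Nat.cast_id, mul_comm] at this
    have h2 : θ (j + N * M) = θ j + 2 * Real.pi := by
      simp only [hθ]
      push_cast
      field_simp
    simp only [h1, h2, suspensionPoint, Real.cos_add_two_pi, Real.sin_add_two_pi]
  · refine (norm_suspensionPoint_sub_le _ _ (hw.norm_eq j)).trans ?_
    have h1 : θ (j + 1) - θ j = 2 * Real.pi / (N * M) := by
      simp only [hθ]
      push_cast
      field_simp
      ring
    have h2 : 2 * Real.pi / (N * M) ≤ 2 * Real.pi / M := by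
      gcongr
      have : (1 : ℝ) ≤ N := by exact_mod_cast hN
      nlinarith
    rw [h1, abs_of_nonneg (by positivity), add_div,
      show 4 * Real.pi / M = 2 * (2 * Real.pi / M) by ring]
    linarith [hw.step_le j]
  · have main : ∀ v : EuclideanSpace ℝ (Fin n), ∀ β : ℝ, 0 ≤ β → ∀ i, ‖v - w i‖ ≤ C / M →
        e = suspensionPoint β v →
        ∃ i, ‖e - suspensionPoint (θ i) (w i)‖ ≤ (C + 4 * Real.pi) / M := by
      rintro v β hβ i hi rfl
      set k := i % N with hk
      have hkN : k < N := Nat.mod_lt _ hN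
      have hwk : w k = w i := hw.periodic.map_mod_nat i
      set m := ⌊β * M / (2 * Real.pi)⌋₊ with hm
      have hm1 : (m : ℝ) ≤ β * M / (2 * Real.pi) := Nat.floor_le (by positivity)
      have hm2 : β * M / (2 * Real.pi) < m + 1 := Nat.lt_floor_add_one _
      have hwj : w (k + m * N) = w i := by
        have := hw.periodic.nat_mul m k
        rwa [Nat.cast_id, hwk] at this
      refine ⟨k + m * N, (norm_suspensionPoint_sub_le _ _ (hw.norm_eq _)).trans ?_⟩
      rw [hwj]
      have hθj : θ (k + m * N) = 2 * Real.pi / M * (k / N + m) := by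
        simp only [hθ]
        push_cast
        field_simp
      have hβ' : β = 2 * Real.pi / M * (β * M / (2 * Real.pi)) := by field_simp
      have hk1 : (k : ℝ) / N < 1 := by
        rw [div_lt_one hN0]
        exact_mod_cast hkN
      have hk0 : 0 ≤ (k : ℝ) / N := by positivity
      have habs : |β - θ (k + m * N)| ≤ 2 * Real.pi / M := by
        rw [hθj, hβ', ← mul_sub, abs_mul, abs_of_pos (show 0 < 2 * Real.pi / M by positivity)]
        refine mul_le_of_le_one_right (by positivity) ?_
        rw [abs_le]
        constructor <;> linarith
      rw [add_div, show 4 * Real.pi / M = 2 * (2 * Real.pi / M) by ring]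
      linarith
    obtain ⟨v, hv, β, hβ, rfl⟩ := exists_eq_suspensionPoint he (hw.norm_eq 0)
    obtain ⟨i, hi | hi⟩ := hdense v hv
    · exact main v β hβ.1 i hi rfl
    · exact main (-v) (2 * Real.pi - β) (by linarith [hβ.2]) i hi
        (suspensionPoint_two_pi_sub_neg β v).symm

theorem exists_isPeriodicWalk_dense_up_to_sign (d : ℕ) : ∃ C : ℝ, 0 < C ∧ ∀ M : ℕ, 1 ≤ M →
    ∃ w : ℕ → EuclideanSpace ℝ (Fin (d + 1)), IsPeriodicWalk (M ^ d) (C / M) w ∧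
      ∀ e, ‖e‖ = 1 → ∃ i, ‖e - w i‖ ≤ C / M ∨ ‖-e - w i‖ ≤ C / M := by
  induction d with
  | zero =>
    -- The sphere `{±1}` has no walk with short steps through both points; a constant walk is dense
    -- up to sign.
    refine ⟨1, one_pos, fun M hM => ⟨fun _ => EuclideanSpace.single 0 1,
      ⟨fun j => by simp, fun j => rfl, fun j => by simp⟩, fun e he => ⟨0, ?_⟩⟩⟩
    have he' : e = EuclideanSpace.single 0 (e 0) := by
      ext i
      rw [Fin.fin_one_eq_zero i]
      simp
    have habs : |e 0| = 1 := by
      rw [he'] at he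
      simpa using he
    rcases (abs_eq zero_le_one).1 habs with h | h
    · left
      rw [he', h]
      simp
    · right
      have : -e = EuclideanSpace.single 0 1 := by
        ext i
        rw [Fin.fin_one_eq_zero i]
        simp [h]
      rw [this]
      simp
  | succ d ih =>
    obtain ⟨C, hC, h⟩ := ih
    refine ⟨C + 4 * Real.pi, by positivity, fun M hM => ?_⟩
    obtain ⟨w, hw, hd⟩ := h M hM
    obtain ⟨w', hw', hd'⟩ := hw.exists_suspension (Nat.one_le_pow _ _ hM) hM hd
    exact ⟨w', by rwa [pow_succ], fun e he => (hd' e he).imp fun i hi => Or.inl hi⟩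

theorem exists_isPeriodicWalk_dense {d : ℕ} (hd : 1 ≤ d) : ∃ C : ℝ, 0 < C ∧ ∀ M : ℕ, 1 ≤ M →
    ∃ w : ℕ → EuclideanSpace ℝ (Fin (d + 1)), IsPeriodicWalk (M ^ d) (C / M) w ∧
      ∀ e, ‖e‖ = 1 → ∃ i, ‖e - w i‖ ≤ C / M := by
  obtain ⟨d, rfl⟩ := Nat.exists_eq_add_of_le' hd
  obtain ⟨C, hC, h⟩ := exists_isPeriodicWalk_dense_up_to_sign d
  refine ⟨C + 4 * Real.pi, by positivity, fun M hM => ?_⟩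
  obtain ⟨w, hw, hd⟩ := h M hM
  rw [pow_succ]
  exact hw.exists_suspension (Nat.one_le_pow _ _ hM) hM hd

/-! ### Binary digits and weighted geometric sums -/

/-- The binary digit of `i` of weight `2 ^ p`. -/
def binaryDigit (p i : ℕ) : ℕ := i / 2 ^ p % 2

theorem binaryDigit_le_one (p i : ℕ) : binaryDigit p i ≤ 1 :=
  Nat.lt_succ_iff.1 (Nat.mod_lt _ two_pos)

theorem sum_binaryDigit_mul_two_pow (q i : ℕ) :
    ∑ p ∈ Finset.range q, binaryDigit p i * 2 ^ p = i % 2 ^ q := by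
  induction q with
  | zero => simp [Nat.mod_one]
  | succ q ih => rw [Finset.sum_range_succ, ih, Nat.mod_pow_succ, binaryDigit, mul_comm (2 ^ q)]

theorem binaryDigit_eq_of_div_eq {q i i' : ℕ} (h : i / 2 ^ q = i' / 2 ^ q) {p : ℕ} (hp : q ≤ p) :
    binaryDigit p i = binaryDigit p i' := by
  obtain ⟨k, rfl⟩ := Nat.exists_eq_add_of_le hp
  rw [binaryDigit, binaryDigit, pow_add, ← Nat.div_div_eq_div_mul, ← Nat.div_div_eq_div_mul, h]

theorem sub_eq_sum_binaryDigit_of_div_eq {q i i' : ℕ} (h : i / 2 ^ q = i' / 2 ^ q) :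
    (i : ℝ) - i' = ∑ p ∈ Finset.range q, ((binaryDigit p i : ℝ) - binaryDigit p i') * 2 ^ p := by
  have key : ∀ k : ℕ, (k : ℝ) = 2 ^ q * (k / 2 ^ q : ℕ)
      + ∑ p ∈ Finset.range q, (binaryDigit p k : ℝ) * 2 ^ p := by
    intro k
    have h1 := sum_binaryDigit_mul_two_pow q k
    have h2 := Nat.div_add_mod k (2 ^ q)
    rw [← h1] at h2
    exact_mod_cast h2.symm
  rw [key i, key i', h]
  simp only [sub_mul, Finset.sum_sub_distrib]
  ring

theorem abs_binaryDigit_sub_le_one (p i i' : ℕ) :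
    |(binaryDigit p i : ℝ) - binaryDigit p i'| ≤ 1 := by
  have h1 : (binaryDigit p i : ℝ) ≤ 1 := by exact_mod_cast binaryDigit_le_one p i
  have h2 : (binaryDigit p i' : ℝ) ≤ 1 := by exact_mod_cast binaryDigit_le_one p i'
  rw [abs_le]
  constructor <;> linarith [Nat.cast_nonneg (α := ℝ) (binaryDigit p i),
    Nat.cast_nonneg (α := ℝ) (binaryDigit p i')]

theorem sum_two_pow_le (q : ℕ) : ∑ p ∈ Finset.range q, (2 : ℝ) ^ p ≤ 2 ^ q := by
  rw [geom_sum_eq (by norm_num)]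
  norm_num

/-- The constant is `∑_{k ≥ 1} (k + 1) ^ 2 / 2 ^ k = 11`. -/
theorem sum_two_pow_mul_sq_le (q : ℕ) :
    ∑ p ∈ Finset.range q, (2 : ℝ) ^ p * ((q : ℝ) - p + 1) ^ 2 ≤ 11 * 2 ^ q := by
  have : ∑ p ∈ Finset.range q, (2 : ℝ) ^ p * ((q : ℝ) - p + 1) ^ 2
      = 11 * 2 ^ q - ((q : ℝ) ^ 2 + 6 * q + 11) := by
    induction q with
    | zero => norm_num
    | succ q ih =>
      rw [Finset.sum_range_succ']
      have : ∑ p ∈ Finset.range q, (2 : ℝ) ^ (p + 1) * (((q + 1 : ℕ) : ℝ) - (p + 1 : ℕ) + 1) ^ 2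
          = 2 * ∑ p ∈ Finset.range q, (2 : ℝ) ^ p * ((q : ℝ) - p + 1) ^ 2 := by
        rw [Finset.mul_sum]
        refine Finset.sum_congr rfl fun p _ => ?_
        push_cast
        ring
      rw [this, ih]
      push_cast
      ring
  rw [this]
  have : (0 : ℝ) ≤ (q : ℝ) ^ 2 + 6 * q + 11 := by positivity
  linarith

theorem norm_sub_le_of_steps {E : Type*} [SeminormedAddCommGroup E] {w : ℕ → E} {ε : ℝ}
    (hstep : ∀ j, ‖w (j + 1) - w j‖ ≤ ε) (p k : ℕ) :
    ‖w (p + k) - w p‖ ≤ k * ε := by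
  induction k with
  | zero => simp
  | succ k ih =>
    have : w (p + (k + 1)) - w p = (w (p + k + 1) - w (p + k)) + (w (p + k) - w p) := by
      rw [← add_assoc]; abel
    rw [this]
    refine (norm_add_le _ _).trans ?_
    push_cast
    linarith [hstep (p + k)]

/-! ### Centres of the spheres and their crossings with a ray -/

section Centre

variable {E : Type*} [NormedAddCommGroup E] [InnerProductSpace ℝ E]

/-- The centre of the `i`-th sphere, of radius `1 + i / 2 ^ L`: its `p`-th binary digit moves the
centre in the direction opposite to `w p` by as much as it increases the radius. -/
noncomputable def sphereCentre (w : ℕ → E) (L P i : ℕ) : E :=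
  -∑ p ∈ Finset.range P, ((binaryDigit p i : ℝ) * 2 ^ p / 2 ^ L) • w p

theorem norm_sphereCentre_le {w : ℕ → E} (hw : ∀ j, ‖w j‖ = 1) (L P i : ℕ) :
    ‖sphereCentre w L P i‖ ≤ 2 ^ P / 2 ^ L := by
  rw [sphereCentre, norm_neg]
  refine (norm_sum_le _ _).trans ?_
  calc _ ≤ ∑ p ∈ Finset.range P, (2 : ℝ) ^ p / 2 ^ L := by
        refine Finset.sum_le_sum fun p _ => ?_
        rw [norm_smul, hw, mul_one, Real.norm_of_nonneg (by positivity)]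
        have : (binaryDigit p i : ℝ) ≤ 1 := by exact_mod_cast binaryDigit_le_one p i
        gcongr
        exact mul_le_of_le_one_left (by positivity) this
    _ ≤ _ := by
        rw [← Finset.sum_div]
        gcongr
        exact sum_two_pow_le P

theorem sphereCentre_sub_of_div_eq (w : ℕ → E) (L : ℕ) {P q i i' : ℕ} (hq : q ≤ P)
    (h : i / 2 ^ q = i' / 2 ^ q) :
    sphereCentre w L P i - sphereCentre w L P i'
      = -∑ p ∈ Finset.range q,
        (((binaryDigit p i : ℝ) - binaryDigit p i') * 2 ^ p / 2 ^ L) • w p := by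
  obtain ⟨k, rfl⟩ := Nat.exists_eq_add_of_le hq
  rw [sphereCentre, sphereCentre, Finset.sum_range_add, Finset.sum_range_add]
  have : ∑ x ∈ Finset.range k, ((binaryDigit (q + x) i : ℝ) * 2 ^ (q + x) / 2 ^ L) • w (q + x)
      = ∑ x ∈ Finset.range k, ((binaryDigit (q + x) i' : ℝ) * 2 ^ (q + x) / 2 ^ L) • w (q + x) :=
    Finset.sum_congr rfl fun x _ => by rw [binaryDigit_eq_of_div_eq h (Nat.le_add_right q x)]
  rw [this]
  simp only [sub_mul, sub_div, sub_smul, Finset.sum_sub_distrib]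
  abel

theorem norm_sphereCentre_sub_le {w : ℕ → E} (hw : ∀ j, ‖w j‖ = 1) (L : ℕ) {P q i i' : ℕ}
    (hq : q ≤ P) (h : i / 2 ^ q = i' / 2 ^ q) :
    ‖sphereCentre w L P i - sphereCentre w L P i'‖ ≤ 2 ^ q / 2 ^ L := by
  rw [sphereCentre_sub_of_div_eq w L hq h, norm_neg]
  refine (norm_sum_le _ _).trans ?_
  calc _ ≤ ∑ p ∈ Finset.range q, (2 : ℝ) ^ p / 2 ^ L := by
        refine Finset.sum_le_sum fun p _ => ?_
        rw [norm_smul, hw, mul_one, Real.norm_eq_abs, mul_div_assoc, abs_mul,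
          abs_of_pos (show (0 : ℝ) < 2 ^ p / 2 ^ L by positivity)]
        exact mul_le_of_le_one_left (by positivity) (abs_binaryDigit_sub_le_one p i i')
    _ ≤ _ := by
        rw [← Finset.sum_div]
        gcongr
        exact sum_two_pow_le q

theorem abs_sub_le_two_pow_of_div_eq {q i i' : ℕ} (h : i / 2 ^ q = i' / 2 ^ q) :
    |(i : ℝ) - i'| ≤ 2 ^ q := by
  rw [sub_eq_sum_binaryDigit_of_div_eq h]
  refine (Finset.abs_sum_le_sum_abs _ _).trans (le_trans ?_ (sum_two_pow_le q))
  refine Finset.sum_le_sum fun p _ => ?_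
  rw [abs_mul, abs_of_pos (show (0 : ℝ) < 2 ^ p by positivity)]
  exact mul_le_of_le_one_left (by positivity) (abs_binaryDigit_sub_le_one p i i')

/-- The heart of the construction: to first order this is the displacement of the crossing with the
ray `e`. Digit `p` contributes the factor `1 - ⟪e, w p⟫ = ‖e - w p‖² / 2`, and walking from `w p` to
`w q` gives `‖e - w p‖ ≤ (q - p + 1) * ε`. -/
theorem abs_radius_add_inner_centre_sub_le {w : ℕ → E} (hw : ∀ j, ‖w j‖ = 1) {ε : ℝ}
    (hstep : ∀ j, ‖w (j + 1) - w j‖ ≤ ε) {e : E} (he : ‖e‖ = 1) (L : ℕ) {P q i i' : ℕ}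
    (hq : q ≤ P) (heq : ‖e - w q‖ ≤ ε) (h : i / 2 ^ q = i' / 2 ^ q) :
    |((i : ℝ) - i') / 2 ^ L + inner ℝ e (sphereCentre w L P i - sphereCentre w L P i')|
      ≤ 11 / 2 * ε ^ 2 * (2 ^ q / 2 ^ L) := by
  have hε : 0 ≤ ε := (norm_nonneg _).trans heq
  have hsum : ((i : ℝ) - i') / 2 ^ L + inner ℝ e (sphereCentre w L P i - sphereCentre w L P i')
      = ∑ p ∈ Finset.range q, ((binaryDigit p i : ℝ) - binaryDigit p i') * 2 ^ p / 2 ^ L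
        * (1 - inner ℝ e (w p)) := by
    rw [sub_eq_sum_binaryDigit_of_div_eq h, sphereCentre_sub_of_div_eq w L hq h, inner_neg_right,
      inner_sum, Finset.sum_div, ← sub_eq_add_neg, ← Finset.sum_sub_distrib]
    refine Finset.sum_congr rfl fun p _ => ?_
    rw [inner_smul_right]
    ring
  rw [hsum]
  refine (Finset.abs_sum_le_sum_abs _ _).trans ?_
  calc _ ≤ ∑ p ∈ Finset.range q,
        ε ^ 2 / 2 / 2 ^ L * ((2 : ℝ) ^ p * ((q : ℝ) - p + 1) ^ 2) := by
        refine Finset.sum_le_sum fun p hp => ?_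
        obtain ⟨k, hk⟩ := Nat.exists_eq_add_of_le (Finset.mem_range.1 hp).le
        have hnorm : ‖e - w p‖ ≤ ((q : ℝ) - p + 1) * ε := by
          have h1 := norm_sub_le_of_steps hstep p k
          rw [← hk] at h1
          have h2 : ‖e - w p‖ ≤ ‖e - w q‖ + ‖w q - w p‖ := by
            rw [show e - w p = (e - w q) + (w q - w p) by abel]
            exact norm_add_le _ _
          have h3 : (q : ℝ) - p = k := by rw [hk]; push_cast; ring
          rw [h3]
          linarith
        have hinner : 1 - inner ℝ e (w p) = ‖e - w p‖ ^ 2 / 2 := by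
          rw [norm_sub_sq_real, he, hw]
          ring
        have hsq : ‖e - w p‖ ^ 2 ≤ (((q : ℝ) - p + 1) * ε) ^ 2 :=
          pow_le_pow_left₀ (norm_nonneg _) hnorm 2
        rw [hinner, abs_mul, mul_div_assoc, abs_mul,
          abs_of_pos (show (0 : ℝ) < 2 ^ p / 2 ^ L by positivity),
          abs_of_nonneg (show 0 ≤ ‖e - w p‖ ^ 2 / 2 by positivity)]
        calc _ ≤ 1 * ((2 : ℝ) ^ p / 2 ^ L) * ((((q : ℝ) - p + 1) * ε) ^ 2 / 2) := by
              gcongr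
              exact abs_binaryDigit_sub_le_one p i i'
          _ = _ := by ring
    _ = ε ^ 2 / 2 / 2 ^ L * ∑ p ∈ Finset.range q, (2 : ℝ) ^ p * ((q : ℝ) - p + 1) ^ 2 := by
        rw [Finset.mul_sum]
    _ ≤ ε ^ 2 / 2 / 2 ^ L * (11 * 2 ^ q) := by
        gcongr
        exact sum_two_pow_mul_sq_le q
    _ = _ := by ring

theorem abs_inner_sq_sub_le {e c c' : E} (he : ‖e‖ = 1) {κ : ℝ} (hc : ‖c‖ ≤ κ) (hc' : ‖c'‖ ≤ κ) :
    |(‖c‖ ^ 2 - inner ℝ e c ^ 2) - (‖c'‖ ^ 2 - inner ℝ e c' ^ 2)| ≤ 4 * κ * ‖c - c'‖ := by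
  have h1 : ‖c‖ ^ 2 - ‖c'‖ ^ 2 = inner ℝ (c - c') (c + c') := by
    rw [inner_add_right, inner_sub_left, inner_sub_left, real_inner_self_eq_norm_sq,
      real_inner_self_eq_norm_sq, real_inner_comm c' c]
    ring
  have h2 : inner ℝ e c ^ 2 - inner ℝ e c' ^ 2
      = inner ℝ e (c - c') * inner ℝ e (c + c') := by
    rw [inner_add_right, inner_sub_right]
    ring
  have hs : ‖c + c'‖ ≤ 2 * κ := (norm_add_le _ _).trans (by linarith)
  have b1 : |inner ℝ (c - c') (c + c')| ≤ ‖c - c'‖ * (2 * κ) :=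
    (abs_real_inner_le_norm _ _).trans (by gcongr)
  have b2 : |inner ℝ e (c - c') * inner ℝ e (c + c')| ≤ ‖c - c'‖ * (2 * κ) := by
    rw [abs_mul]
    have u1 := abs_real_inner_le_norm e (c - c')
    have u2 := abs_real_inner_le_norm e (c + c')
    rw [he, one_mul] at u1 u2
    exact mul_le_mul u1 (u2.trans hs) (abs_nonneg _) (norm_nonneg _)
  rw [show (‖c‖ ^ 2 - inner ℝ e c ^ 2) - (‖c'‖ ^ 2 - inner ℝ e c' ^ 2)
    = (‖c‖ ^ 2 - ‖c'‖ ^ 2) - (inner ℝ e c ^ 2 - inner ℝ e c' ^ 2) by ring, h1, h2]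
  refine (abs_sub _ _).trans ?_
  linarith

/-- A point `ρ • e` at distance `s` from `c` satisfies `ρ = s + ⟪e, c⟫` up to second order in `c`. -/
theorem ray_sphere_first_order {e c : E} (he : ‖e‖ = 1) {κ ρ : ℝ} (hκ : κ ≤ 1 / 4)
    (hc : ‖c‖ ≤ κ) (hρ : 0 < ρ) (hs : 1 / 2 ≤ ‖ρ • e - c‖) :
    (ρ - inner ℝ e c) ^ 2 = ‖ρ • e - c‖ ^ 2 - (‖c‖ ^ 2 - inner ℝ e c ^ 2) ∧
    1 / 4 ≤ ρ - inner ℝ e c ∧ ρ - inner ℝ e c ≤ ‖ρ • e - c‖ ∧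
    ‖ρ • e - c‖ - (ρ - inner ℝ e c) ≤ κ / 2 := by
  have hsq : ‖ρ • e - c‖ ^ 2 = ρ ^ 2 - 2 * (ρ * inner ℝ e c) + ‖c‖ ^ 2 := by
    rw [norm_sub_sq_real, norm_smul, he, mul_one, Real.norm_eq_abs, sq_abs, inner_smul_left]
    simp
  have hin : |inner ℝ e c| ≤ ‖c‖ := by
    have := abs_real_inner_le_norm e c
    rwa [he, one_mul] at this
  set t := inner ℝ e c with ht
  set s := ‖ρ • e - c‖ with hsdef
  have hin' := abs_le.1 hin
  have hκ0 : 0 ≤ κ := (norm_nonneg c).trans hc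
  have htsq : t ^ 2 ≤ ‖c‖ ^ 2 := sq_le_sq' (by linarith [hin'.1]) hin'.2
  have hcsq : ‖c‖ ^ 2 ≤ κ ^ 2 := pow_le_pow_left₀ (norm_nonneg _) hc 2
  have heq : (ρ - t) ^ 2 = s ^ 2 - (‖c‖ ^ 2 - t ^ 2) := by rw [hsq]; ring
  -- Positivity of `ρ` excludes the negative root of the quadratic equation.
  have hA : 1 / 4 ≤ ρ - t := by
    have h1 : -(1 / 4) < ρ - t := by linarith [hin'.2]
    by_contra! h2
    have : (ρ - t) ^ 2 < (1 / 4) ^ 2 := sq_lt_sq' h1 h2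
    nlinarith [sq_nonneg t]
  refine ⟨heq, hA, ?_, ?_⟩
  · nlinarith
  · by_contra! h
    nlinarith [sq_nonneg t]

/-- Bounding the two second-order errors separately would lose the factor `2 ^ q / 2 ^ L`; their
difference is instead Lipschitz in the distances and the centres, with constant `O(κ)`. -/
theorem abs_sub_sub_inner_le {e c c' : E} (he : ‖e‖ = 1) {κ ρ ρ' : ℝ} (hκ : κ ≤ 1 / 4)
    (hc : ‖c‖ ≤ κ) (hc' : ‖c'‖ ≤ κ) (hρ : 0 < ρ) (hρ' : 0 < ρ')
    (hs : 1 / 2 ≤ ‖ρ • e - c‖) (hs' : 1 / 2 ≤ ‖ρ' • e - c'‖) :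
    |ρ - ρ' - (‖ρ • e - c‖ - ‖ρ' • e - c'‖) - inner ℝ e (c - c')|
      ≤ 2 * κ * |‖ρ • e - c‖ - ‖ρ' • e - c'‖| + 8 * κ * ‖c - c'‖ := by
  obtain ⟨h1, h2, h3, h4⟩ := ray_sphere_first_order he hκ hc hρ hs
  obtain ⟨h1', h2', h3', h4'⟩ := ray_sphere_first_order he hκ hc' hρ' hs'
  have hB := abs_inner_sq_sub_le he hc hc'
  set s := ‖ρ • e - c‖
  set s' := ‖ρ' • e - c'‖
  set A := ρ - inner ℝ e c with hA
  set A' := ρ' - inner ℝ e c' with hA'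
  rw [inner_sub_right, show ρ - ρ' - (s - s') - (inner ℝ e c - inner ℝ e c')
    = A - A' - (s - s') by rw [hA, hA']; ring]
  set X := A - A' - (s - s') with hX
  have hid : X * (A + A') = (s - s') * ((s - A) + (s' - A'))
      - ((‖c‖ ^ 2 - inner ℝ e c ^ 2) - (‖c'‖ ^ 2 - inner ℝ e c' ^ 2)) := by
    rw [hX]; linear_combination h1 - h1'
  have hbound : |X| * (A + A') ≤ |s - s'| * κ + 4 * κ * ‖c - c'‖ := by
    rw [← abs_of_pos (show 0 < A + A' by linarith), ← abs_mul, hid]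
    refine (abs_sub _ _).trans (add_le_add ?_ hB)
    rw [abs_mul]
    gcongr
    rw [abs_of_nonneg (by linarith)]
    linarith
  have : |X| * (1 / 2) ≤ |X| * (A + A') := by
    gcongr
    linarith
  linarith

end Centre

/-! ### The compact set -/

/-- The union of the annuli of width `2 ^ (-L)` around the points `c i`, with inner radii
`1 + i / 2 ^ L`. -/
def dyadicAnnuli {E : Type*} [PseudoMetricSpace E] (L : ℕ) (c : ℕ → E) : Set E :=
  ⋃ i ∈ Finset.range (2 ^ L),
    {x | dist x (c i) ∈ Set.Icc (1 + (i : ℝ) / 2 ^ L) (1 + (i : ℝ) / 2 ^ L + 1 / 2 ^ L)}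

theorem isCompact_dyadicAnnuli {E : Type*} [PseudoMetricSpace E] [ProperSpace E] (L : ℕ)
    (c : ℕ → E) : IsCompact (dyadicAnnuli L c) := by
  refine Finset.isCompact_biUnion _ fun i _ => ?_
  refine (isCompact_closedBall (c i) (1 + (i : ℝ) / 2 ^ L + 1 / 2 ^ L)).of_isClosed_subset ?_ ?_
  · exact isClosed_Icc.preimage (f := fun x => dist x (c i)) (by fun_prop)
  · exact fun x hx => hx.2

theorem exists_dyadic_interval_mem (L : ℕ) {r : ℝ} (hr : r ∈ Set.Icc (1 : ℝ) 2) :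
    ∃ i : ℕ, i < 2 ^ L ∧ r ∈ Set.Icc (1 + (i : ℝ) / 2 ^ L) (1 + (i : ℝ) / 2 ^ L + 1 / 2 ^ L) := by
  have hL : (0 : ℝ) < 2 ^ L := by positivity
  rcases hr.2.lt_or_eq with h2 | rfl
  · have h0 : 0 ≤ (r - 1) * 2 ^ L := mul_nonneg (by linarith [hr.1]) hL.le
    have h3 := Nat.floor_le h0
    have h4 := Nat.lt_floor_add_one ((r - 1) * 2 ^ L)
    refine ⟨⌊(r - 1) * 2 ^ L⌋₊, ?_, ?_, ?_⟩
    · rw [Nat.floor_lt h0]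
      push_cast
      nlinarith
    · rw [← le_sub_iff_add_le', div_le_iff₀ hL]
      exact h3
    · rw [add_assoc, ← sub_le_iff_le_add', ← add_div, le_div_iff₀ hL]
      exact h4.le
  -- At `r = 2` the floor would be `2 ^ L`, one too many; the closed last interval contains this
  -- endpoint.
  · refine ⟨2 ^ L - 1, Nat.sub_lt (by positivity) one_pos, ?_⟩
    have : ((2 ^ L - 1 : ℕ) : ℝ) = 2 ^ L - 1 := by
      rw [Nat.cast_sub Nat.one_le_two_pow]
      push_cast
      ring
    rw [this]
    have e : 1 + ((2 : ℝ) ^ L - 1) / 2 ^ L + 1 / 2 ^ L = 2 := by field_simp; ring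
    refine ⟨?_, e.ge⟩
    have : 0 < 1 / (2 : ℝ) ^ L := by positivity
    linarith

theorem containsAllSpheres_dyadicAnnuli {d : ℕ} (L : ℕ)
    (c : ℕ → EuclideanSpace ℝ (Fin (d + 1))) : ContainsAllSpheres d (dyadicAnnuli L c) := by
  intro r hr
  obtain ⟨i, hi, hmem⟩ := exists_dyadic_interval_mem L hr
  refine ⟨c i, fun x hx => Set.mem_biUnion (Finset.mem_coe.2 (Finset.mem_range.2 hi)) ?_⟩
  have hx' : dist x (c i) = r := hx
  rwa [Set.mem_ofPred_eq, hx']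

theorem exists_of_mem_thickening_dyadicAnnuli {E : Type*} [PseudoMetricSpace E] {L : ℕ}
    {c : ℕ → E} {x : E} (hx : x ∈ Metric.thickening (1 / 2 ^ L) (dyadicAnnuli L c)) :
    ∃ i < 2 ^ L, |dist x (c i) - (1 + (i : ℝ) / 2 ^ L)| ≤ 2 * (1 / 2 ^ L) := by
  obtain ⟨z, hz, hxz⟩ := Metric.mem_thickening_iff.1 hx
  obtain ⟨i, hi, hz1, hz2⟩ := Set.mem_iUnion₂.1 hz
  refine ⟨i, Finset.mem_range.1 hi, ?_⟩
  have h1 := abs_dist_sub_le x z (c i)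
  rw [abs_le] at h1 ⊢
  constructor <;> linarith [h1.1, h1.2, show 0 ≤ 1 / (2 : ℝ) ^ L by positivity]

theorem sq_le_four_pow (M : ℕ) : (M : ℝ) ^ 2 ≤ 2 ^ (2 * M) := by
  have : (M : ℝ) ≤ 2 ^ M := by exact_mod_cast Nat.lt_two_pow_self.le
  rw [mul_comm, pow_mul]
  exact pow_le_pow_left₀ (Nat.cast_nonneg M) this 2

theorem norm_le_three_of_mem_thickening {E : Type*} [NormedAddCommGroup E] {L : ℕ} (hL : 2 ≤ L)
    {c : ℕ → E} (hc : ∀ i, ‖c i‖ ≤ 1 / 4) {x : E}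
    (hx : x ∈ Metric.thickening (1 / 2 ^ L) (dyadicAnnuli L c)) : ‖x‖ ≤ 3 := by
  obtain ⟨i, hi, hd⟩ := exists_of_mem_thickening_dyadicAnnuli hx
  have h0 : (0 : ℝ) < 2 ^ L := by positivity
  have h1 : (1 : ℝ) / 2 ^ L ≤ 1 / 2 ^ 2 :=
    one_div_le_one_div_of_le (by positivity) (pow_le_pow_right₀ one_le_two hL)
  have h2 : (i : ℝ) / 2 ^ L ≤ 1 - 1 / 2 ^ L := by
    rw [div_le_iff₀ h0, sub_mul, div_mul_cancel₀ _ h0.ne', one_mul, le_sub_iff_add_le]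
    exact_mod_cast hi
  have h3 : ‖x‖ ≤ dist x (c i) + ‖c i‖ := by
    rw [dist_eq_norm]
    simpa using norm_add_le (x - c i) (c i)
  linarith [(abs_le.1 hd).2, hc i]

/-! ### Length of the radial slices -/

section Slices

variable {E : Type*} [NormedAddCommGroup E] [InnerProductSpace ℝ E]

/-- The surplus `L - P = 2 * M` keeps the centres below `4⁻ᴹ ≤ M⁻²`, which controls the second-order
error; `2 * M ≤ q` makes the width `1 / 2 ^ L` at most `4⁻ᴹ * (2 ^ q / 2 ^ L)`. These errors add up
to `16 * κ * η`, within the allowance of 22. -/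
theorem abs_sub_le_of_div_eq {w : ℕ → E} {ε : ℝ} {M P q i i' : ℕ} (hM : 1 ≤ M)
    (hw : ∀ j, ‖w j‖ = 1) (hstep : ∀ j, ‖w (j + 1) - w j‖ ≤ ε) {e : E} (he : ‖e‖ = 1)
    (hq : 2 * M ≤ q) (hqP : q ≤ P) (heq : ‖e - w q‖ ≤ ε) (h : i / 2 ^ q = i' / 2 ^ q) {ρ ρ' : ℝ}
    (hρ : 0 < ρ) (hρ' : 0 < ρ')
    (hs : |dist (ρ • e) (sphereCentre w (P + 2 * M) P i) - (1 + (i : ℝ) / 2 ^ (P + 2 * M))|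
      ≤ 2 * (1 / 2 ^ (P + 2 * M)))
    (hs' : |dist (ρ' • e) (sphereCentre w (P + 2 * M) P i') - (1 + (i' : ℝ) / 2 ^ (P + 2 * M))|
      ≤ 2 * (1 / 2 ^ (P + 2 * M))) :
    |ρ - ρ'| ≤ (11 / 2 * ε ^ 2 + 22 / (M : ℝ) ^ 2) * (2 ^ q / 2 ^ (P + 2 * M)) := by
  have hM0 : (0 : ℝ) < M := by exact_mod_cast hM
  set L := P + 2 * M with hL
  set c := sphereCentre w L P i with hc
  set c' := sphereCentre w L P i' with hc'
  set κ : ℝ := 1 / 2 ^ (2 * M) with hκ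
  set η : ℝ := 2 ^ q / 2 ^ L with hη
  set κM : ℝ := 1 / (M : ℝ) ^ 2 with hκM
  have hη0 : 0 < η := by positivity
  have hκ0 : 0 < κ := by positivity
  have hκ1 : κ ≤ κM := one_div_le_one_div_of_le (by positivity) (sq_le_four_pow M)
  have hκ2 : κ ≤ 1 / 4 := by
    rw [hκ, show (4 : ℝ) = 2 ^ 2 by norm_num]
    exact one_div_le_one_div_of_le (by positivity) (pow_le_pow_right₀ one_le_two (by omega))
  have hPκ : (2 : ℝ) ^ P / 2 ^ L = κ := by
    rw [hL, pow_add, hκ]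
    field_simp
  have hcn : ‖c‖ ≤ κ := hPκ ▸ norm_sphereCentre_le hw L P i
  have hcn' : ‖c'‖ ≤ κ := hPκ ▸ norm_sphereCentre_le hw L P i'
  have hcc : ‖c - c'‖ ≤ η := norm_sphereCentre_sub_le hw L hqP h
  have hh : 1 / (2 : ℝ) ^ L ≤ κ * η := by
    rw [hκ, hη, div_mul_div_comm, one_mul, div_le_div_iff₀ (by positivity) (by positivity), one_mul]
    have : (2 : ℝ) ^ (2 * M) ≤ 2 ^ q := pow_le_pow_right₀ one_le_two hq
    exact mul_le_mul_of_nonneg_right this (by positivity)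
  have hη1 : η ≤ 1 := by
    rw [hη, div_le_one (by positivity)]
    exact pow_le_pow_right₀ one_le_two (by omega)
  have hh1 : 1 / (2 : ℝ) ^ L ≤ 1 / 4 := hh.trans (by nlinarith)
  have hr : |((i : ℝ) - i') / 2 ^ L| ≤ η := by
    rw [abs_div, abs_of_pos (show (0 : ℝ) < 2 ^ L by positivity)]
    exact div_le_div_of_nonneg_right (abs_sub_le_two_pow_of_div_eq h) (by positivity)
  have key := abs_radius_add_inner_centre_sub_le hw hstep he L hqP heq h
  rw [dist_eq_norm] at hs hs'
  have hi0 : 0 ≤ (i : ℝ) / 2 ^ L := by positivity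
  have hi0' : 0 ≤ (i' : ℝ) / 2 ^ L := by positivity
  have geo := abs_sub_sub_inner_le he hκ2 hcn hcn' hρ hρ'
    (by linarith [(abs_le.1 hs).1]) (by linarith [(abs_le.1 hs').1])
  set s := ‖ρ • e - c‖
  set s' := ‖ρ' • e - c'‖
  have hss : |(s - s') - ((i : ℝ) - i') / 2 ^ L| ≤ 4 * (κ * η) := by
    rw [sub_div]
    rw [abs_le] at hs hs' ⊢
    constructor <;> linarith [hs.1, hs.2, hs'.1, hs'.2]
  have hss' : |s - s'| ≤ 2 * η := by
    have : |s - s'| ≤ |(s - s') - ((i : ℝ) - i') / 2 ^ L| + |((i : ℝ) - i') / 2 ^ L| := by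
      simpa using abs_add_le ((s - s') - ((i : ℝ) - i') / 2 ^ L) (((i : ℝ) - i') / 2 ^ L)
    nlinarith
  have hgeo : |ρ - ρ' - (s - s') - inner ℝ e (c - c')| ≤ 12 * (κ * η) := by
    have h1 : 2 * κ * |s - s'| ≤ 2 * κ * (2 * η) := by gcongr
    have h2 : 8 * κ * ‖c - c'‖ ≤ 8 * κ * η := by gcongr
    linarith
  have hκη : κ * η ≤ κM * η := by gcongr
  have hκη0 : 0 < κM * η := by positivity
  rw [show (22 : ℝ) / (M : ℝ) ^ 2 = 22 * κM by rw [hκM]; ring, add_mul]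
  rw [abs_le] at key hss hgeo ⊢
  constructor <;> linarith [key.1, key.2, hss.1, hss.2, hgeo.1, hgeo.2]

theorem volume_radial_slice_le {w : ℕ → E} {ε : ℝ} {M P q : ℕ} (hM : 1 ≤ M)
    (hw : ∀ j, ‖w j‖ = 1) (hstep : ∀ j, ‖w (j + 1) - w j‖ ≤ ε) {e : E} (he : ‖e‖ = 1)
    (hq : 2 * M ≤ q) (hqP : q ≤ P) (heq : ‖e - w q‖ ≤ ε) :
    volume {ρ : ℝ | 0 < ρ ∧ ρ • e ∈ Metric.thickening (1 / 2 ^ (P + 2 * M))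
      (dyadicAnnuli (P + 2 * M) (sphereCentre w (P + 2 * M) P))}
      ≤ ENNReal.ofReal (11 / 2 * ε ^ 2 + 22 / (M : ℝ) ^ 2) := by
  set L := P + 2 * M with hL
  set D : ℝ := (11 / 2 * ε ^ 2 + 22 / (M : ℝ) ^ 2) * (2 ^ q / 2 ^ L) with hD
  -- Blocks of indices with the same digits from `q` on: there are `2 ^ (L - q)`, each of diameter
  -- at most `D`, so the powers of two cancel.
  set T : ℕ → Set ℝ := fun m => {ρ | 0 < ρ ∧ ∃ i, i / 2 ^ q = m ∧
    |dist (ρ • e) (sphereCentre w L P i) - (1 + (i : ℝ) / 2 ^ L)| ≤ 2 * (1 / 2 ^ L)} with hT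
  have hsub : {ρ : ℝ | 0 < ρ ∧ ρ • e ∈ Metric.thickening (1 / 2 ^ L)
      (dyadicAnnuli L (sphereCentre w L P))} ⊆ ⋃ m ∈ Finset.range (2 ^ (L - q)), T m := by
    rintro ρ ⟨hρ, hmem⟩
    obtain ⟨i, hi, hd⟩ := exists_of_mem_thickening_dyadicAnnuli hmem
    refine Set.mem_biUnion (Finset.mem_coe.2 (Finset.mem_range.2 (?_ : i / 2 ^ q < _)))
      ⟨hρ, i, rfl, hd⟩
    rw [Nat.div_lt_iff_lt_mul (by positivity), ← pow_add, Nat.sub_add_cancel (by omega)]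
    exact hi
  have hTm : ∀ m, volume (T m) ≤ ENNReal.ofReal D := by
    intro m
    refine (Real.volume_le_diam _).trans (Metric.ediam_le ?_)
    rintro ρ ⟨hρ, i, hi, hd⟩ ρ' ⟨hρ', i', hi', hd'⟩
    rw [edist_dist, Real.dist_eq]
    exact ENNReal.ofReal_le_ofReal
      (abs_sub_le_of_div_eq hM hw hstep he hq hqP heq (hi.trans hi'.symm) hρ hρ' hd hd')
  calc _ ≤ ∑ m ∈ Finset.range (2 ^ (L - q)), volume (T m) :=
        (measure_mono hsub).trans (measure_biUnion_finset_le _ _)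
    _ ≤ ∑ m ∈ Finset.range (2 ^ (L - q)), ENNReal.ofReal D :=
        Finset.sum_le_sum fun m _ => hTm m
    _ = ENNReal.ofReal (2 ^ (L - q) * D) := by
        rw [Finset.sum_const, Finset.card_range, nsmul_eq_mul,
          ENNReal.ofReal_mul (show (0 : ℝ) ≤ 2 ^ (L - q) by positivity),
          ENNReal.ofReal_pow zero_le_two]
        simp
    _ = _ := by
        have h1 : (2 : ℝ) ^ L = 2 ^ (L - q) * 2 ^ q := by
          rw [← pow_add, Nat.sub_add_cancel (by omega)]
        rw [hD, h1]
        congr 1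
        field_simp

end Slices

/-! ### Choice of parameters and the upper bound -/

theorem exists_compact_containsAllSpheres_volume_le {d : ℕ} (hd : 1 ≤ d) :
    ∃ C : ℝ, 0 < C ∧ ∀ M : ℕ, 1 ≤ M → ∃ K : Set (EuclideanSpace ℝ (Fin (d + 1))),
      IsCompact K ∧ ContainsAllSpheres d K ∧
        volume (Metric.thickening (1 / 2 ^ (M ^ d + 4 * M)) K)
          ≤ ENNReal.ofReal (C / (M : ℝ) ^ 2) := by
  obtain ⟨C, hC, hwalk⟩ := exists_isPeriodicWalk_dense hd
  set σ := (volume : Measure (EuclideanSpace ℝ (Fin (d + 1)))).toSphere.real Set.univ with hσ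
  have hσ0 : 0 ≤ σ := measureReal_nonneg
  refine ⟨σ * (3 ^ d * (11 / 2 * C ^ 2 + 22)) + 1, by positivity, fun M hM => ?_⟩
  have hM0 : (0 : ℝ) < M := by exact_mod_cast hM
  obtain ⟨w₀, hw₀, hdense⟩ := hwalk M hM
  -- Truncated subtraction holds the walk at `w₀ 0` for the lowest `2 * M` digits, so every
  -- direction is approached at some `q ≥ 2 * M`.
  set w : ℕ → EuclideanSpace ℝ (Fin (d + 1)) := fun p => w₀ (p - 2 * M) with hw
  have hnorm : ∀ j, ‖w j‖ = 1 := fun j => hw₀.norm_eq _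
  have hstep : ∀ j, ‖w (j + 1) - w j‖ ≤ C / M := by
    intro j
    rcases lt_or_ge j (2 * M) with h | h
    · have : w (j + 1) = w j := by
        simp only [hw]
        congr 1
        omega
      rw [this, sub_self, norm_zero]
      positivity
    · simp only [hw]
      rw [Nat.sub_add_comm h]
      exact hw₀.step_le _
  set P := M ^ d + 2 * M with hP
  rw [show M ^ d + 4 * M = P + 2 * M by rw [hP]; ring]
  refine ⟨dyadicAnnuli (P + 2 * M) (sphereCentre w (P + 2 * M) P), isCompact_dyadicAnnuli _ _,
    containsAllSpheres_dyadicAnnuli _ _, ?_⟩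
  have hcentre : ∀ i, ‖sphereCentre w (P + 2 * M) P i‖ ≤ 1 / 4 := by
    intro i
    refine (norm_sphereCentre_le hnorm _ _ _).trans ?_
    rw [pow_add _ P, div_le_div_iff₀ (by positivity) (by positivity), one_mul]
    have : (4 : ℝ) ≤ 2 ^ (2 * M) := by
      calc (4 : ℝ) = 2 ^ 2 := by norm_num
        _ ≤ _ := pow_le_pow_right₀ one_le_two (by omega)
    exact mul_le_mul_of_nonneg_left this (by positivity)
  have hslice : ∀ e : EuclideanSpace ℝ (Fin (d + 1)), ‖e‖ = 1 →
      volume {ρ : ℝ | 0 < ρ ∧ ρ • e ∈ Metric.thickening (1 / 2 ^ (P + 2 * M))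
        (dyadicAnnuli (P + 2 * M) (sphereCentre w (P + 2 * M) P))}
        ≤ ENNReal.ofReal ((11 / 2 * C ^ 2 + 22) / (M : ℝ) ^ 2) := by
    intro e he
    obtain ⟨i, hi⟩ := hdense e he
    have hlt : i % M ^ d < M ^ d := Nat.mod_lt _ (by positivity)
    refine (volume_radial_slice_le (q := 2 * M + i % M ^ d) hM hnorm hstep he
      (Nat.le_add_right _ _) (by omega) ?_).trans (le_of_eq ?_)
    · simp only [hw, Nat.add_sub_cancel_left]
      rwa [hw₀.periodic.map_mod_nat]
    · congr 1
      field_simp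
  refine (measure_le_of_radial_slices volume (d := d) (by simp) Metric.isOpen_thickening.measurableSet
    (fun x hx => norm_le_three_of_mem_thickening (by omega) hcentre hx) hslice).trans ?_
  rw [← ofReal_measureReal, ← hσ, ← ENNReal.ofReal_mul (by positivity), ← ENNReal.ofReal_mul hσ0]
  refine ENNReal.ofReal_le_ofReal ?_
  rw [← mul_div_assoc, ← mul_div_assoc]
  gcongr
  linarith

theorem exists_compact_containsAllSpheres_thickening_le {d : ℕ} (hd : 1 ≤ d) :
    ∃ C : ℝ, 0 < C ∧ ∀ δ : ℝ, 0 < δ → δ < 1 →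
      ∃ K : Set (EuclideanSpace ℝ (Fin (d + 1))), IsCompact K ∧ ContainsAllSpheres d K ∧
        volume (Metric.thickening δ K)
          ≤ ENNReal.ofReal (C * |Real.log δ| ^ (-(2 / (d : ℝ)))) := by
  obtain ⟨C, hC, hK⟩ := exists_compact_containsAllSpheres_volume_le hd
  have hd0 : (0 : ℝ) < d := by exact_mod_cast hd
  set V := (volume : Measure (EuclideanSpace ℝ (Fin (d + 1)))).real (Metric.ball 0 3) with hV
  have hV0 : 0 ≤ V := measureReal_nonneg
  -- As `M ^ d + 4 * M ≤ 5 * M ^ d`, the scale `1 / 2 ^ (M ^ d + 4 * M)` is at least `δ` once `M ^ d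
  -- * b ≤ Λ`.
  set b : ℝ := 5 * Real.log 2 with hb
  have hb0 : 0 < b := by have := Real.log_pos one_lt_two; positivity
  refine ⟨(4 * C + V) * b ^ (2 / (d : ℝ)), by positivity, fun δ hδ hδ1 => ?_⟩
  set Λ := |Real.log δ| with hΛ
  have hlog : Real.log δ < 0 := Real.log_neg hδ hδ1
  have hΛ0 : 0 < Λ := abs_pos.2 hlog.ne
  have hbound : (4 * C + V) * b ^ (2 / (d : ℝ)) * Λ ^ (-(2 / (d : ℝ)))
      = (4 * C + V) * ((Λ / b) ^ (2 / (d : ℝ)))⁻¹ := by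
    rw [Real.rpow_neg hΛ0.le, Real.div_rpow hΛ0.le hb0.le]
    field_simp
  rw [hbound]
  rcases lt_or_ge Λ b with hlt | hge
  -- Here `M` would be zero; as `Λ` is bounded, a fixed ball suffices and accounts for `V` in the
  -- constant.
  · refine ⟨Metric.closedBall 0 2, isCompact_closedBall _ _, fun r hr => ⟨0, fun x hx => ?_⟩, ?_⟩
    · rw [mem_sphere_zero_iff_norm] at hx
      rw [mem_closedBall_zero_iff, hx]
      exact hr.2
    · have hsub : Metric.thickening δ (Metric.closedBall (0 : EuclideanSpace ℝ (Fin (d + 1))) 2)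
          ⊆ Metric.ball 0 3 := by
        intro x hx
        obtain ⟨z, hz, hxz⟩ := Metric.mem_thickening_iff.1 hx
        have := dist_triangle x z 0
        rw [Metric.mem_closedBall] at hz
        rw [Metric.mem_ball]
        linarith
      refine (measure_mono hsub).trans ?_
      rw [← ofReal_measureReal measure_ball_lt_top.ne, ← hV]
      refine ENNReal.ofReal_le_ofReal ?_
      have h1 : (Λ / b) ^ (2 / (d : ℝ)) ≤ 1 :=
        Real.rpow_le_one (by positivity) ((div_le_one hb0).2 hlt.le) (by positivity)
      have h2 : 1 ≤ ((Λ / b) ^ (2 / (d : ℝ)))⁻¹ := (one_le_inv₀ (by positivity)).2 h1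
      nlinarith
  · set x := (Λ / b) ^ (1 / (d : ℝ)) with hx
    have hx1 : 1 ≤ x := Real.one_le_rpow ((one_le_div hb0).2 hge) (by positivity)
    have hxd : x ^ d = Λ / b := by
      rw [hx, ← Real.rpow_natCast, ← Real.rpow_mul (by positivity), one_div_mul_cancel hd0.ne',
        Real.rpow_one]
    have hx2 : (Λ / b) ^ (2 / (d : ℝ)) = x ^ 2 := by
      rw [hx, ← Real.rpow_natCast, ← Real.rpow_mul (by positivity)]
      congr 1
      push_cast
      ring
    have hM1 : 1 ≤ ⌊x⌋₊ := Nat.le_floor (by simpa using hx1)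
    set M := ⌊x⌋₊ with hM
    have hMx : (M : ℝ) ≤ x := Nat.floor_le (by linarith)
    have hxM : x < M + 1 := Nat.lt_floor_add_one x
    have hM1' : (1 : ℝ) ≤ M := by exact_mod_cast hM1
    obtain ⟨K, hKc, hKs, hKv⟩ := hK M hM1
    refine ⟨K, hKc, hKs, ((measure_mono (Metric.thickening_mono ?_ K)).trans hKv).trans
      (ENNReal.ofReal_le_ofReal ?_)⟩
    · have hMd : (M : ℝ) ≤ (M : ℝ) ^ d := le_self_pow₀ hM1' (by omega)
      have hMd' : (M : ℝ) ^ d ≤ Λ / b := hxd ▸ pow_le_pow_left₀ (by positivity) hMx d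
      rw [le_div_iff₀ hb0] at hMd'
      rw [← Real.log_le_log_iff hδ (by positivity), one_div, Real.log_inv, Real.log_pow]
      have hΛ' : Real.log δ = -Λ := by rw [hΛ, abs_of_neg hlog, neg_neg]
      rw [hΛ']
      push_cast
      have : ((M : ℝ) ^ d + 4 * M) * Real.log 2 ≤ (5 * (M : ℝ) ^ d) * Real.log 2 := by
        gcongr
        linarith
      nlinarith
    · rw [hx2, ← div_eq_mul_inv, div_le_div_iff₀ (by positivity) (by positivity)]
      -- Rounding `x` down costs at most a factor 2, hence the `4 * C`.
      have : x ^ 2 ≤ (2 * (M : ℝ)) ^ 2 := pow_le_pow_left₀ (by positivity) (by linarith) 2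
      nlinarith [mul_nonneg hV0 (sq_nonneg (M : ℝ))]

theorem theorem1p1 :
    (∀ d : ℕ, 1 ≤ d → ∃ C : ℝ, 0 < C ∧ ∀ δ : ℝ, 0 < δ → δ < 1 →
      ∃ K : Set (EuclideanSpace ℝ (Fin (d + 1))), IsCompact K ∧ ContainsAllSpheres d K ∧
        volume (Metric.thickening δ K)
          ≤ ENNReal.ofReal (C * |Real.log δ| ^ (-(2 / (d : ℝ))))) ∧
    (∃ c : ℝ, 0 < c ∧ ∀ δ : ℝ, 0 < δ → δ ≤ 1 / 2 →
      ∀ K : Set (EuclideanSpace ℝ (Fin (2 + 1))), IsCompact K → ContainsAllSpheres 2 K →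
        ENNReal.ofReal (c * |Real.log δ| ^ (-1 : ℝ)) ≤ volume (Metric.thickening δ K)) :=
  ⟨fun _ hd => exists_compact_containsAllSpheres_thickening_le hd,
    Real.pi / 75, by positivity, fun _ hδ hδ2 _ hK hKs =>
      volume_thickening_ge_of_containsAllSpheres hδ hδ2 hK hKs⟩
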